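/- Let $n\ge 1$ agents have local objectives $f_i:\mathbb{R}^r\to\mathbb{R}$ that are differentiable, $\mu$-strongly convex and have $L$-Lipschitz gradients ($\mu,L>0$), i.e. $\langle\nabla f_i(x)-\nabla f_i(x'),x-x'\rangle\ge\mu\|x-x'\|^2$ and $\|\nabla f_i(x)-\nabla f_i(x')\|\le L\|x-x'\|$ for all $x,x'\in\mathbb{R}^r$, and let $x^*$ be the minimizer of $f=\frac1n\sum_{i=1}^n f_i$. Let $W=[w_{ij}]\in\mathbb{R}^{n\times n}$ be nonnegative, symmetric and doubly stochastic with $w_{ii}>0$ for all $i$, such that the graph with an edge between $i\ne j$ whenever $w_{ij}>0$ is connected. Let the random vectors $\eta_{i,k},\xi_{i,k}\in\mathbb{R}^r$ ($1\le i\le n$, $k\ge0$) have mutually independent entries (over iterations, agents, coordinates and between $\eta$ and $\xi$) with mean zero, finite variances, and $\mathbb{E}\sum_i\|\eta_{i,k}\|^2\le\sigma_\eta^2$, $\mathbb{E}\sum_i\|\xi_{i,k}\|^2\le\sigma_\xi^2$ for all $k$, where $\sigma_\eta,\sigma_\xi>0$. From arbitrary deterministic $s_{i,0},x_{i,0}\in\mathbb{R}^r$,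 the algorithm iterates $$s_{i,k+1}=w_{ii}s_{i,k}+\sum_{j\ne i}w_{ij}(s_{j,k}+\beta_k\eta_{j,k})+\gamma_k\nabla f_i(x_{i,k}),$$ $$x_{i,k+1}=w_{ii}x_{i,k}+\sum_{j\ne i}w_{ij}(x_{j,k}+\beta_k\xi_{j,k})-\alpha(s_{i,k+1}-s_{i,k}),$$ with $\gamma_k=\gamma/(m+k)^p$, $\beta_k=1/(m+k)^q$, $\alpha,\gamma>0$, $m>0$. Put $y_{i,k}=s_{i,k+1}-s_{i,k}$, $\bar x_k=\frac1n\sum_i x_{i,k}$, $\bar y_k=\frac1n\sum_i y_{i,k}$. Let $p=0$ (so $\gamma_k=\gamma$), let $\rho_w$ be the spectral radius of $W-\frac{\mathbf 1\mathbf 1^T}{n}$ and $d_I=\|I-\frac{\mathbf 1\mathbf 1^T}{n}\|$ in the Frobenius norm (so $d_I^2=n-1$), and suppose $$\alpha\gamma<\min\left\{\frac{2}{\mu+L},\ \frac{1-\rho_w^2}{4\sqrt2\,L\,d_I},\ \sqrt{\frac{2}{c_{42}+\sqrt{c_{42}^2+4c_{41}}}}\right\},$$ $$c_{41}=\frac{64(1+\rho_w^2)(3\mu+L)L^6d_I^2}{(1-\rho_w^2)^4(\mu+L)},\qquad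 c_{42}=\frac{64(1+\rho_w^2)(\mu^2+2\mu L+5L^2)L^2d_I^2}{(1-\rho_w^2)^4(\mu+L)^2}$$ (for $n=1$ the last two terms of the minimum are $+\infty$). Then there are constants $a\in(0,1)$ and $C>0$, independent of $k$ and $q$, such that for all sufficiently large $q$ the following holds with the $m>0$ determined by $\left(\frac{m}{m+1}\right)^{2q}=a$: for all integers $0\le k\le q$, the three expectations below are finite and $$\mathbb{E}\|\bar x_k-x^*\|^2\le C\,e^{-\frac{4k}{2+\ln(1/a)}},\qquad \mathbb{E}\sum_{i}\|x_{i,k}-\bar x_k\|^2\le C\,e^{-\frac{4k}{2+\ln(1/a)}},\qquad \mathbb{E}\sum_{i}\|y_{i,k}-\bar y_k\|^2\le C\,e^{-\frac{4k}{2+\ln(1/a)}}.$$ -/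

import Mathlib

open MeasureTheory ProbabilityTheory Filter

namespace DPGradTracking

noncomputable section

/-- Decision variables live in `ℝ^r` with the Euclidean norm. -/
abbrev Vec (r : ℕ) : Type := EuclideanSpace ℝ (Fin r)

/-- The global objective `f = (1/n) ∑ᵢ fᵢ`. -/
def globalObj {n r : ℕ} (f : Fin n → Vec r → ℝ) (x : Vec r) : ℝ :=
  (1 / (n : ℝ)) * ∑ i, f i x

/-- Each `fᵢ` is differentiable and `μ`-strongly convex with an `L`-Lipschitz gradient. -/
structure ObjectiveAssumption {n r : ℕ} (f : Fin n → Vec r → ℝ) (μ L : ℝ) : Prop where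
  mu_pos : 0 < μ
  L_pos : 0 < L
  differentiable : ∀ i, Differentiable ℝ (f i)
  strong : ∀ i x x', μ * ‖x - x'‖ ^ 2 ≤ inner ℝ (gradient (f i) x - gradient (f i) x') (x - x')
  lipschitz : ∀ i x x', ‖gradient (f i) x - gradient (f i) x'‖ ≤ L * ‖x - x'‖

/-- The communication graph induced by `W`: distinct agents are linked iff their weight is positive
(`W` is symmetric wherever this is used). -/
def commGraph {n : ℕ} (W : Matrix (Fin n) (Fin n) ℝ) : SimpleGraph (Fin n) :=
  SimpleGraph.fromRel fun i j => 0 < W i j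

/-- The coupling matrix is nonnegative, doubly stochastic and symmetric, has a positive diagonal,
and its graph is connected. -/
structure NetworkAssumption {n : ℕ} (W : Matrix (Fin n) (Fin n) ℝ) : Prop where
  nonneg : ∀ i j, 0 ≤ W i j
  row_sum : ∀ i, ∑ j, W i j = 1
  col_sum : ∀ j, ∑ i, W i j = 1
  symm : W.IsSymm
  diag_pos : ∀ i, 0 < W i i
  connected : (commGraph W).Connected

/-- All scalar noise entries `η_{ij,k}`, `ξ_{ij,k}` are mutually independent (over iterations `k`,
agents `i`, coordinates `j`), have mean zero and finite variance, and
`𝔼‖η_k‖² ≤ σ_η²`, `𝔼‖ξ_k‖² ≤ σ_ξ²`. -/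
structure NoiseAssumption {n r : ℕ} {Ω : Type*} [MeasurableSpace Ω] (P : Measure Ω)
    (η ξ : ℕ → Fin n → Ω → Vec r) (ση σξ : ℝ) : Prop where
  indep : iIndepFun
    (fun (z : (ℕ × Fin n × Fin r) ⊕ (ℕ × Fin n × Fin r)) (ω : Ω) =>
      Sum.elim (fun t => η t.1 t.2.1 ω t.2.2) (fun t => ξ t.1 t.2.1 ω t.2.2) z) P
  memLp_eta : ∀ k i j, MemLp (fun ω => η k i ω j) 2 P
  memLp_xi : ∀ k i j, MemLp (fun ω => ξ k i ω j) 2 P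
  mean_eta : ∀ k i j, ∫ ω, η k i ω j ∂P = 0
  mean_xi : ∀ k i j, ∫ ω, ξ k i ω j ∂P = 0
  sigma_eta_pos : 0 < ση
  sigma_xi_pos : 0 < σξ
  var_eta : ∀ k, ∫ ω, ∑ i, ‖η k i ω‖ ^ 2 ∂P ≤ ση ^ 2
  var_xi : ∀ k, ∫ ω, ∑ i, ‖ξ k i ω‖ ^ 2 ∂P ≤ σξ ^ 2

/-- Step sizes `γ_k = γ / (m + k)^p`. -/
def gammaSeq (γ m p : ℝ) (k : ℕ) : ℝ := γ / (m + k) ^ p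

/-- Noise factors `β_k = 1 / (m + k)^q`. -/
def betaSeq (m q : ℝ) (k : ℕ) : ℝ := 1 / (m + k) ^ q

/-- The algorithm, for given noise values: `algState … k = (s_k, x_k)`, the agents' tracking
variables and decision variables after `k` iterations. -/
def algState {n r : ℕ} (W : Matrix (Fin n) (Fin n) ℝ) (f : Fin n → Vec r → ℝ)
    (α : ℝ) (γ β : ℕ → ℝ) (s₀ x₀ : Fin n → Vec r) (η ξ : ℕ → Fin n → Vec r) :
    ℕ → (Fin n → Vec r) × (Fin n → Vec r)
  | 0 => (s₀, x₀)
  | k + 1 =>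
    let s := (algState W f α γ β s₀ x₀ η ξ k).1
    let x := (algState W f α γ β s₀ x₀ η ξ k).2
    let s' : Fin n → Vec r := fun i =>
      W i i • s i + ∑ j ∈ Finset.univ.erase i, W i j • (s j + β k • η k j)
        + γ k • gradient (f i) (x i)
    let x' : Fin n → Vec r := fun i =>
      W i i • x i + ∑ j ∈ Finset.univ.erase i, W i j • (x j + β k • ξ k j)
        - α • (s' i - s i)
    (s', x')

/-- The tracking variables `s_k`, as random vectors. -/
def sIter {n r : ℕ} {Ω : Type*} (W : Matrix (Fin n) (Fin n) ℝ) (f : Fin n → Vec r → ℝ)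
    (α : ℝ) (γ β : ℕ → ℝ) (s₀ x₀ : Fin n → Vec r) (η ξ : ℕ → Fin n → Ω → Vec r)
    (k : ℕ) (ω : Ω) : Fin n → Vec r :=
  (algState W f α γ β s₀ x₀ (fun l i => η l i ω) (fun l i => ξ l i ω) k).1

/-- The decision variables `x_k`, as random vectors. -/
def xIter {n r : ℕ} {Ω : Type*} (W : Matrix (Fin n) (Fin n) ℝ) (f : Fin n → Vec r → ℝ)
    (α : ℝ) (γ β : ℕ → ℝ) (s₀ x₀ : Fin n → Vec r) (η ξ : ℕ → Fin n → Ω → Vec r)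
    (k : ℕ) (ω : Ω) : Fin n → Vec r :=
  (algState W f α γ β s₀ x₀ (fun l i => η l i ω) (fun l i => ξ l i ω) k).2

/-- The gradient trackers `y_k = s_{k+1} - s_k`. -/
def yIter {n r : ℕ} {Ω : Type*} (W : Matrix (Fin n) (Fin n) ℝ) (f : Fin n → Vec r → ℝ)
    (α : ℝ) (γ β : ℕ → ℝ) (s₀ x₀ : Fin n → Vec r) (η ξ : ℕ → Fin n → Ω → Vec r)
    (k : ℕ) (ω : Ω) : Fin n → Vec r :=
  sIter W f α γ β s₀ x₀ η ξ (k + 1) ω - sIter W f α γ β s₀ x₀ η ξ k ω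

/-- The average over agents, `(1/n) 1ᵀ z`. -/
def agentAvg {n r : ℕ} (z : Fin n → Vec r) : Vec r := (1 / (n : ℝ)) • ∑ i, z i

/-- The squared consensus error `‖z - 1 z̄‖₂²`, for the matrix norm `matNorm` below. -/
def consensusSq {n r : ℕ} (z : Fin n → Vec r) : ℝ := ∑ i, ‖z i - agentAvg z‖ ^ 2

/-- The averaging matrix `11ᵀ/n`. -/
def avgMatrix (n : ℕ) : Matrix (Fin n) (Fin n) ℝ := Matrix.of fun _ _ => 1 / (n : ℝ)

/-- The matrix norm `‖A‖₂`: the 2-norm of the vector of the 2-norms of the columns. -/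
def matNorm {n r : ℕ} (A : Matrix (Fin n) (Fin r) ℝ) : ℝ :=
  Real.sqrt (∑ j, ∑ i, A i j ^ 2)

/-- `d_I = ‖I - 11ᵀ/n‖₂`. -/
def dI (n : ℕ) : ℝ := matNorm (1 - avgMatrix n)

/-- `ρ_w`, the spectral radius of `W - 11ᵀ/n`; this matrix is symmetric under
`NetworkAssumption`, so that its spectrum is real. -/
def rhoW {n : ℕ} (W : Matrix (Fin n) (Fin n) ℝ) : ℝ :=
  (spectralRadius ℝ (W - avgMatrix n)).toReal

/-- The constant `c₄₁`. -/
def c41 {n : ℕ} (W : Matrix (Fin n) (Fin n) ℝ) (μ L : ℝ) : ℝ :=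
  64 * (1 + rhoW W ^ 2) * (3 * μ + L) * L ^ 6 * dI n ^ 2
    / ((1 - rhoW W ^ 2) ^ 4 * (μ + L))

/-- The constant `c₄₂`. -/
def c42 {n : ℕ} (W : Matrix (Fin n) (Fin n) ℝ) (μ L : ℝ) : ℝ :=
  64 * (1 + rhoW W ^ 2) * (μ ^ 2 + 2 * μ * L + 5 * L ^ 2) * L ^ 2 * dI n ^ 2
    / ((1 - rhoW W ^ 2) ^ 4 * (μ + L) ^ 2)

/-- The bound `αγ < min {2/(μ+L), (1-ρ_w²)/(4√2 L d_I), √(2/(c₄₂+√(c₄₂²+4c₄₁)))}`. For `n = 1`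
one has `d_I = c₄₁ = c₄₂ = 0`, and the last two terms are read as `+∞`. -/
def StepsizeCondition {n : ℕ} (W : Matrix (Fin n) (Fin n) ℝ) (μ L α γ : ℝ) : Prop :=
  α * γ < 2 / (μ + L) ∧
    (1 < n →
      α * γ < (1 - rhoW W ^ 2) / (4 * Real.sqrt 2 * L * dI n) ∧
      α * γ < Real.sqrt (2 / (c42 W μ L + Real.sqrt (c42 W μ L ^ 2 + 4 * c41 W μ L))))

end

end DPGradTracking

open DPGradTracking

/-!
Averaging over the agents cancels the mixing matrix: the mean tracker is `γ` times the mean of the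
local gradients, up to noise. Hence the average decision performs inexact gradient descent on the
global objective, with an error controlled by the consensus error of the decisions, while `W`
contracts both consensus errors by the factor `ρ_w`. With suitable weights, the step size condition
makes the optimality gap plus the two consensus errors a Lyapunov function that decreases
geometrically in the absence of noise; the gap decreases by the descent lemma and the
Polyak–Łojasiewicz inequality.

The noise perturbs one step additively, so by Young's inequality the errors are bounded along every
sample path by `K (λ ^ k + ∑_{l ≤ k} β_l ^ 2 ‖noise_l‖ ^ 2)`, and only the second moments of the
noise matter. Taking `a = exp (-M)` with `M = -4 / log λ` gives `λ ^ k ≤ exp (-4 k / (2 + M))`. The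
offset `m` determined by `a` tends to infinity with `q`, and as soon as `m ≥ e ^ 2` one has
`β_l ^ 2 ≤ exp (-4 q)`, so that the noise contributes at most a multiple of `exp (-2 k)`.
-/

namespace DPGradTracking

/-! ### Smooth functions on a Hilbert space -/

section Hilbert

variable {E : Type*} [NormedAddCommGroup E] [InnerProductSpace ℝ E] [CompleteSpace E]

/-- `L`-smoothness: `g` is differentiable and its gradient is `L`-Lipschitz. The constant is a real
number, as in `ObjectiveAssumption`. -/
structure HasLipschitzGradient (L : ℝ) (g : E → ℝ) : Prop where
  differentiable : Differentiable ℝ g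
  norm_gradient_sub_le : ∀ x x', ‖gradient g x - gradient g x'‖ ≤ L * ‖x - x'‖

/-- Strong monotonicity of the gradient, which for differentiable functions is strong convexity. -/
def HasStronglyMonotoneGradient (μ : ℝ) (g : E → ℝ) : Prop :=
  ∀ x x', μ * ‖x - x'‖ ^ 2 ≤ inner ℝ (gradient g x - gradient g x') (x - x')

variable {g : E → ℝ}

theorem hasDerivAt_comp_add_smul (hg : Differentiable ℝ g) (x v : E) (t : ℝ) :
    HasDerivAt (fun t : ℝ => g (x + t • v)) (inner ℝ (gradient g (x + t • v)) v) t := by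
  have hline : HasDerivAt (fun t : ℝ => x + t • v) v t := by
    simpa using ((hasDerivAt_id t).smul_const v).const_add x
  rw [inner_gradient_left]
  exact (hg (x + t • v)).hasFDerivAt.comp_hasDerivAt t hline

theorem le_quadratic_of_inner_gradient_sub_le (hg : Differentiable ℝ g) {c : ℝ}
    (h : ∀ x x', inner ℝ (gradient g x - gradient g x') (x - x') ≤ c * ‖x - x'‖ ^ 2) (x v : E) :
    g (x + v) ≤ g x + inner ℝ (gradient g x) v + c / 2 * ‖v‖ ^ 2 := by
  have hderiv : ∀ t : ℝ, HasDerivAt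
      (fun t : ℝ => g (x + t • v) - t * inner ℝ (gradient g x) v - c / 2 * ‖v‖ ^ 2 * t ^ 2)
      (inner ℝ (gradient g (x + t • v)) v - 1 * inner ℝ (gradient g x) v
        - c / 2 * ‖v‖ ^ 2 * (2 * t)) t := fun t => by
    refine ((hasDerivAt_comp_add_smul hg x v t).sub ((hasDerivAt_id t).mul_const _)).sub ?_
    simpa using (hasDerivAt_pow 2 t).const_mul (c / 2 * ‖v‖ ^ 2)
  obtain ⟨t, ⟨ht, -⟩, hslope⟩ := exists_hasDerivAt_eq_slope _ _ (zero_lt_one' ℝ)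
    (fun t _ => (hderiv t).continuousAt.continuousWithinAt) (fun t _ => hderiv t)
  have hmono : inner ℝ (gradient g (x + t • v)) v - inner ℝ (gradient g x) v
      ≤ c * ‖v‖ ^ 2 * t := by
    have := h (x + t • v) x
    rw [add_sub_cancel_left, real_inner_smul_right, inner_sub_left, norm_smul, mul_pow,
      Real.norm_eq_abs, sq_abs] at this
    exact le_of_mul_le_mul_left (by linarith) ht
  simp only [one_smul, zero_smul, add_zero, one_mul, one_pow, sub_zero, div_one, mul_one, zero_mul,
    zero_pow two_ne_zero, mul_zero] at hslope
  linarith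

theorem quadratic_le_of_le_inner_gradient_sub (hg : Differentiable ℝ g) {c : ℝ}
    (h : ∀ x x', c * ‖x - x'‖ ^ 2 ≤ inner ℝ (gradient g x - gradient g x') (x - x')) (x v : E) :
    g x + inner ℝ (gradient g x) v + c / 2 * ‖v‖ ^ 2 ≤ g (x + v) := by
  have hgrad : ∀ x, gradient (-g) x = -gradient g x := fun x => by
    simp [gradient, fderiv_neg]
  have := le_quadratic_of_inner_gradient_sub_le (c := -c) hg.neg (fun x x' => by
    rw [hgrad, hgrad, ← neg_sub', inner_neg_left]
    linarith [h x x']) x v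
  rw [hgrad, inner_neg_left] at this
  simp only [Pi.neg_apply] at this
  linarith

theorem gradient_eq_zero_of_forall_le {xstar : E} (hx : ∀ x, g xstar ≤ g x) :
    gradient g xstar = 0 := by
  have : IsLocalMin g xstar := Eventually.of_forall hx
  simp [gradient, this.fderiv_eq_zero]

variable {μ L : ℝ}

theorem HasLipschitzGradient.le_quadratic (hg : HasLipschitzGradient L g) (x v : E) :
    g (x + v) ≤ g x + inner ℝ (gradient g x) v + L / 2 * ‖v‖ ^ 2 := by
  refine le_quadratic_of_inner_gradient_sub_le hg.differentiable (fun x x' => ?_) x v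
  calc inner ℝ (gradient g x - gradient g x') (x - x')
      ≤ ‖gradient g x - gradient g x'‖ * ‖x - x'‖ := real_inner_le_norm _ _
    _ ≤ L * ‖x - x'‖ * ‖x - x'‖ := by gcongr; exact hg.norm_gradient_sub_le x x'
    _ = L * ‖x - x'‖ ^ 2 := by ring

theorem HasLipschitzGradient.continuous_gradient (hg : HasLipschitzGradient L g) :
    Continuous (gradient g) := by
  refine (LipschitzWith.of_dist_le' (K := L) fun x y => ?_).continuous
  simpa only [dist_eq_norm] using hg.norm_gradient_sub_le x y

theorem HasStronglyMonotoneGradient.mul_norm_sub_sq_le (hmono : HasStronglyMonotoneGradient μ g)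
    (hg : Differentiable ℝ g) {xstar : E} (hx : ∀ x, g xstar ≤ g x) (x : E) :
    μ / 2 * ‖x - xstar‖ ^ 2 ≤ g x - g xstar := by
  have h := quadratic_le_of_le_inner_gradient_sub hg hmono xstar (x - xstar)
  rw [gradient_eq_zero_of_forall_le hx, inner_zero_left, add_sub_cancel] at h
  linarith

/-- The Polyak–Łojasiewicz inequality. -/
theorem HasStronglyMonotoneGradient.mul_sub_le_norm_gradient_sq
    (hmono : HasStronglyMonotoneGradient μ g) (hg : Differentiable ℝ g) (hμ : 0 ≤ μ) (x x' : E) :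
    2 * μ * (g x - g x') ≤ ‖gradient g x‖ ^ 2 := by
  have hquad := quadratic_le_of_le_inner_gradient_sub hg hmono x (x' - x)
  have hsq : 0 ≤ ‖gradient g x + μ • (x' - x)‖ ^ 2 := sq_nonneg _
  rw [add_sub_cancel] at hquad
  rw [norm_add_sq_real, real_inner_smul_right, norm_smul, mul_pow, Real.norm_eq_abs,
    sq_abs] at hsq
  linear_combination 2 * μ * hquad + hsq

theorem mul_norm_gradient_sq_le (hg : HasLipschitzGradient L g)
    (hmono : HasStronglyMonotoneGradient μ g) (hμ : 0 ≤ μ) {xstar : E}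
    (hx : ∀ x, g xstar ≤ g x) (x : E) :
    μ * ‖gradient g x‖ ^ 2 ≤ 2 * L ^ 2 * (g x - g xstar) := by
  have hlip := hg.norm_gradient_sub_le x xstar
  rw [gradient_eq_zero_of_forall_le hx, sub_zero] at hlip
  have hgrowth := hmono.mul_norm_sub_sq_le hg.differentiable hx x
  calc μ * ‖gradient g x‖ ^ 2 ≤ μ * (L * ‖x - xstar‖) ^ 2 := by gcongr
    _ = 2 * L ^ 2 * (μ / 2 * ‖x - xstar‖ ^ 2) := by ring
    _ ≤ 2 * L ^ 2 * (g x - g xstar) := by gcongr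

theorem exists_gap_add_le (hg : HasLipschitzGradient L g)
    (hmono : HasStronglyMonotoneGradient μ g) (hμ : 0 < μ) (hL : 0 < L) {xstar : E}
    (hx : ∀ x, g xstar ≤ g x) {ε : ℝ} (hε : 0 < ε) :
    ∃ K, 0 < K ∧ ∀ x u, g (x + u) - g xstar ≤ (1 + ε) * (g x - g xstar) + K * ‖u‖ ^ 2 := by
  refine ⟨L / 2 + L ^ 2 / (2 * ε * μ), by positivity, fun x u => ?_⟩
  have hquad := hg.le_quadratic x u
  have hinner := real_inner_le_norm (gradient g x) u
  have hgrad := mul_norm_gradient_sq_le hg hmono hμ.le hx x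
  set d := ‖gradient g x‖
  -- Young's inequality, weighted so that the gradient term costs exactly `ε` times the gap
  have hyoung : d * ‖u‖ ≤ ε / (2 * L ^ 2) * (μ * d ^ 2) + L ^ 2 / (2 * ε * μ) * ‖u‖ ^ 2 := by
    have hsq : 0 ≤ (ε * μ * d - L ^ 2 * ‖u‖) ^ 2 / (2 * ε * μ * L ^ 2) := by positivity
    have hexpand : (ε * μ * d - L ^ 2 * ‖u‖) ^ 2 / (2 * ε * μ * L ^ 2)
        = ε / (2 * L ^ 2) * (μ * d ^ 2) - d * ‖u‖ + L ^ 2 / (2 * ε * μ) * ‖u‖ ^ 2 := by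
      field_simp
      ring
    linarith
  have hgap : ε / (2 * L ^ 2) * (μ * d ^ 2) ≤ ε * (g x - g xstar) := by
    calc ε / (2 * L ^ 2) * (μ * d ^ 2) ≤ ε / (2 * L ^ 2) * (2 * L ^ 2 * (g x - g xstar)) := by
          gcongr
      _ = ε * (g x - g xstar) := by field_simp
  linarith

end Hilbert

/-! ### Stacks of vectors -/

open scoped Matrix.Module

section Stack

variable {ι E : Type*} [Fintype ι] [NormedAddCommGroup E]

/-- The squared Euclidean norm of a stack of vectors, one for each agent. The norm of the function
type `ι → E` would be the supremum norm. -/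
def stackNormSq (z : ι → E) : ℝ := ∑ i, ‖z i‖ ^ 2

theorem stackNormSq_nonneg (z : ι → E) : 0 ≤ stackNormSq z :=
  Finset.sum_nonneg fun _ _ => sq_nonneg _

theorem stackNormSq_const (v : E) : stackNormSq (fun _ : ι => v) = Fintype.card ι * ‖v‖ ^ 2 := by
  simp [stackNormSq]

theorem norm_add_sq_le_of_pos {c : ℝ} (hc : 0 < c) (a b : E) :
    ‖a + b‖ ^ 2 ≤ (1 + c) * ‖a‖ ^ 2 + (1 + 1 / c) * ‖b‖ ^ 2 := by
  have htri : ‖a + b‖ ^ 2 ≤ (‖a‖ + ‖b‖) ^ 2 := by gcongr; exact norm_add_le a b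
  have hsq : 0 ≤ (c * ‖a‖ - ‖b‖) ^ 2 / c := by positivity
  have hexpand : (c * ‖a‖ - ‖b‖) ^ 2 / c = c * ‖a‖ ^ 2 - 2 * ‖a‖ * ‖b‖ + 1 / c * ‖b‖ ^ 2 := by
    field_simp
    ring
  linarith

theorem stackNormSq_add_le {c : ℝ} (hc : 0 < c) (a b : ι → E) :
    stackNormSq (a + b) ≤ (1 + c) * stackNormSq a + (1 + 1 / c) * stackNormSq b := by
  simp only [stackNormSq, Finset.mul_sum, ← Finset.sum_add_distrib]
  exact Finset.sum_le_sum fun i _ => norm_add_sq_le_of_pos hc (a i) (b i)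

theorem stackNormSq_neg (z : ι → E) : stackNormSq (-z) = stackNormSq z := by
  simp [stackNormSq]

theorem stackNormSq_sub_le {c : ℝ} (hc : 0 < c) (a b : ι → E) :
    stackNormSq (a - b) ≤ (1 + c) * stackNormSq a + (1 + 1 / c) * stackNormSq b := by
  simpa only [sub_eq_add_neg, stackNormSq_neg] using stackNormSq_add_le hc a (-b)

theorem stackNormSq_eq_zero {z : ι → E} : stackNormSq z = 0 ↔ z = 0 := by
  simp [stackNormSq, Finset.sum_eq_zero_iff_of_nonneg, funext_iff]

/-- The parameter of Young's inequality is the one that turns the factor `θ` into the midpoint of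
`θ` and `1`. -/
theorem stackNormSq_add_le_of_contraction {θ X : ℝ} (hθ0 : 0 ≤ θ) (hθ1 : θ < 1) (hX : 0 ≤ X)
    {a : ι → E} (ha : stackNormSq a ≤ θ * X) (b : ι → E) :
    stackNormSq (a + b) ≤ (1 + θ) / 2 * X + (1 + θ) / (1 - θ) * stackNormSq b := by
  rcases hθ0.eq_or_lt with rfl | hθ
  · have ha0 : a = 0 := stackNormSq_eq_zero.1 (le_antisymm (by simpa using ha)
      (stackNormSq_nonneg a))
    simpa [ha0] using hX
  · have hδ : 0 < 1 - θ := by linarith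
    have hc : 0 < (1 - θ) / (2 * θ) := by positivity
    calc stackNormSq (a + b)
        ≤ (1 + (1 - θ) / (2 * θ)) * stackNormSq a
          + (1 + 1 / ((1 - θ) / (2 * θ))) * stackNormSq b := stackNormSq_add_le hc a b
      _ ≤ (1 + (1 - θ) / (2 * θ)) * (θ * X)
          + (1 + 1 / ((1 - θ) / (2 * θ))) * stackNormSq b := by gcongr
      _ = (1 + θ) / 2 * X + (1 + θ) / (1 - θ) * stackNormSq b := by
        congr 1
        · field_simp
          ring
        · congr 1
          field_simp
          ring

variable [NormedSpace ℝ E]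

theorem stackNormSq_smul (c : ℝ) (z : ι → E) : stackNormSq (c • z) = c ^ 2 * stackNormSq z := by
  simp [stackNormSq, Finset.mul_sum, norm_smul, mul_pow]

end Stack

section Spectral

variable {ι E : Type*} [Fintype ι] [DecidableEq ι] [NormedAddCommGroup E] [InnerProductSpace ℝ E]

theorem sum_inner_matrix_smul_left (A : Matrix ι ι ℝ) (z w : ι → E) :
    ∑ i, inner ℝ ((A • z) i) (w i) = ∑ i, inner ℝ (z i) ((A.transpose • w) i) := by
  simp only [Matrix.Module.smul_apply, sum_inner, inner_sum, real_inner_smul_left,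
    real_inner_smul_right, Matrix.transpose_apply]
  exact Finset.sum_comm

theorem stackNormSq_orthogonal_smul {U : Matrix ι ι ℝ} (hU : U ∈ Matrix.orthogonalGroup ι ℝ)
    (z : ι → E) : stackNormSq (U • z) = stackNormSq z := by
  have hUU : U.transpose * U = 1 := (Matrix.mem_orthogonalGroup_iff' ι ℝ).1 hU
  simp only [stackNormSq, ← real_inner_self_eq_norm_sq]
  rw [sum_inner_matrix_smul_left, smul_smul, hUU, one_smul]

theorem stackNormSq_diagonal_smul_le {d : ι → ℝ} {c : ℝ} (hd : ∀ i, |d i| ≤ c) (z : ι → E) :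
    stackNormSq (Matrix.diagonal d • z) ≤ c ^ 2 * stackNormSq z := by
  rw [stackNormSq, stackNormSq, Finset.mul_sum]
  refine Finset.sum_le_sum fun i _ => ?_
  have hi : (Matrix.diagonal d • z) i = d i • z i := by
    simp [Matrix.diagonal_apply]
  rw [hi, norm_smul, mul_pow, Real.norm_eq_abs]
  gcongr
  exact hd i

theorem abs_eigenvalues_le_spectralRadius {A : Matrix ι ι ℝ} (hA : A.IsHermitian) (i : ι) :
    |hA.eigenvalues i| ≤ (spectralRadius ℝ A).toReal := by
  have hfin : spectralRadius ℝ A ≠ ⊤ := by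
    obtain ⟨B, hB⟩ := (A.finite_real_spectrum.image fun k : ℝ => ‖k‖₊).bddAbove
    refine ne_top_of_le_ne_top (ENNReal.coe_ne_top (r := B)) (iSup₂_le fun k hk => ?_)
    exact ENNReal.coe_le_coe.2 (hB ⟨k, hk, rfl⟩)
  have hle : (‖hA.eigenvalues i‖₊ : ENNReal) ≤ spectralRadius ℝ A :=
    le_iSup₂ (f := fun (k : ℝ) (_ : k ∈ spectrum ℝ A) => (‖k‖₊ : ENNReal)) _
      (hA.eigenvalues_mem_spectrum_real i)
  simpa using ENNReal.toReal_mono hfin hle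

theorem stackNormSq_matrix_smul_le_spectralRadius {A : Matrix ι ι ℝ} (hA : A.IsHermitian)
    (z : ι → E) : stackNormSq (A • z) ≤ (spectralRadius ℝ A).toReal ^ 2 * stackNormSq z := by
  set U := (hA.eigenvectorUnitary : Matrix ι ι ℝ)
  have hU : U ∈ Matrix.orthogonalGroup ι ℝ := hA.eigenvectorUnitary.2
  have hdiag : A = U * Matrix.diagonal hA.eigenvalues * star U := by
    simpa [Unitary.conjStarAlgAut_apply] using hA.spectral_theorem
  calc stackNormSq (A • z)
      = stackNormSq (Matrix.diagonal hA.eigenvalues • (star U • z)) := by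
        conv_lhs => rw [hdiag]
        rw [mul_smul, mul_smul, stackNormSq_orthogonal_smul hU]
    _ ≤ (spectralRadius ℝ A).toReal ^ 2 * stackNormSq (star U • z) :=
        stackNormSq_diagonal_smul_le (abs_eigenvalues_le_spectralRadius hA) _
    _ = (spectralRadius ℝ A).toReal ^ 2 * stackNormSq z := by
        rw [stackNormSq_orthogonal_smul (Unitary.star_mem hU)]

end Spectral

/-! ### Averages and consensus errors -/

section Average

variable {n r : ℕ}

theorem agentAvg_add (a b : Fin n → Vec r) : agentAvg (a + b) = agentAvg a + agentAvg b := by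
  simp [agentAvg, Finset.sum_add_distrib]

theorem agentAvg_smul (c : ℝ) (a : Fin n → Vec r) : agentAvg (c • a) = c • agentAvg a := by
  simp only [agentAvg, Pi.smul_apply, ← Finset.smul_sum, smul_comm c]

theorem agentAvg_sub (a b : Fin n → Vec r) : agentAvg (a - b) = agentAvg a - agentAvg b := by
  simp [agentAvg, Finset.sum_sub_distrib, smul_sub]

theorem sum_eq_smul_agentAvg (hn : 0 < n) (z : Fin n → Vec r) :
    ∑ i, z i = (n : ℝ) • agentAvg z := by
  have : (n : ℝ) ≠ 0 := by positivity
  rw [agentAvg, smul_smul, mul_one_div_cancel this, one_smul]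

theorem consensusSq_eq_stackNormSq (z : Fin n → Vec r) :
    consensusSq z = stackNormSq (z - Function.const _ (agentAvg z)) := rfl

theorem consensusSq_nonneg (z : Fin n → Vec r) : 0 ≤ consensusSq z := stackNormSq_nonneg _

theorem stackNormSq_eq_consensusSq_add (hn : 0 < n) (z : Fin n → Vec r) :
    stackNormSq z = consensusSq z + n * ‖agentAvg z‖ ^ 2 := by
  have hcross : ∑ i, inner ℝ (z i) (agentAvg z) = n * ‖agentAvg z‖ ^ 2 := by
    rw [← sum_inner, sum_eq_smul_agentAvg hn, real_inner_smul_left, real_inner_self_eq_norm_sq]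
  simp only [stackNormSq, consensusSq, norm_sub_sq_real, Finset.sum_add_distrib,
    Finset.sum_sub_distrib, ← Finset.mul_sum, hcross, Finset.sum_const, Finset.card_univ,
    Fintype.card_fin, nsmul_eq_mul]
  ring

theorem consensusSq_le_stackNormSq (hn : 0 < n) (z : Fin n → Vec r) :
    consensusSq z ≤ stackNormSq z := by
  rw [stackNormSq_eq_consensusSq_add hn]
  exact le_add_of_nonneg_right (by positivity)

theorem mul_norm_agentAvg_sq_le_stackNormSq (hn : 0 < n) (z : Fin n → Vec r) :
    n * ‖agentAvg z‖ ^ 2 ≤ stackNormSq z := by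
  rw [stackNormSq_eq_consensusSq_add hn]
  exact le_add_of_nonneg_left (consensusSq_nonneg z)

theorem consensusSq_add_eq (a b : Fin n → Vec r) :
    consensusSq (a + b) = stackNormSq ((a - Function.const _ (agentAvg a))
      + (b - Function.const _ (agentAvg b))) := by
  rw [consensusSq_eq_stackNormSq, agentAvg_add]
  congr 1
  ext1 i
  simp only [Pi.sub_apply, Pi.add_apply, Function.const_apply]
  abel

theorem consensusSq_add_le (hn : 0 < n) {c : ℝ} (hc : 0 < c) (a b : Fin n → Vec r) :
    consensusSq (a + b) ≤ (1 + c) * consensusSq a + (1 + 1 / c) * stackNormSq b := by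
  rw [consensusSq_add_eq]
  refine (stackNormSq_add_le hc _ _).trans (add_le_add_right ?_ _)
  exact mul_le_mul_of_nonneg_left (consensusSq_le_stackNormSq hn b) (by positivity)

theorem consensusSq_add_le_of_contraction {θ X : ℝ} (hθ0 : 0 ≤ θ) (hθ1 : θ < 1)
    (hX : 0 ≤ X) {a : Fin n → Vec r} (ha : consensusSq a ≤ θ * X) (b : Fin n → Vec r) :
    consensusSq (a + b) ≤ (1 + θ) / 2 * X + (1 + θ) / (1 - θ) * consensusSq b := by
  rw [consensusSq_add_eq]
  exact stackNormSq_add_le_of_contraction hθ0 hθ1 hX ha _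

theorem consensusSq_smul (c : ℝ) (z : Fin n → Vec r) :
    consensusSq (c • z) = c ^ 2 * consensusSq z := by
  rw [consensusSq_eq_stackNormSq, consensusSq_eq_stackNormSq, agentAvg_smul, ← stackNormSq_smul,
    smul_sub]
  rfl

theorem dI_sq (hn : 0 < n) : dI n ^ 2 = n - 1 := by
  have h0 : (n : ℝ) ≠ 0 := by positivity
  have hentry : ∀ i j : Fin n, (1 - avgMatrix n) i j ^ 2
      = (if i = j then 1 - 2 / (n : ℝ) else 0) + 1 / (n : ℝ) ^ 2 := by
    intro i j
    by_cases hij : i = j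
    · subst hij
      simp only [avgMatrix, Matrix.sub_apply, Matrix.one_apply_eq, Matrix.of_apply, if_true]
      ring
    · simp [avgMatrix, hij]
  rw [dI, matNorm,
    Real.sq_sqrt (Finset.sum_nonneg fun _ _ => Finset.sum_nonneg fun _ _ => sq_nonneg _)]
  simp only [hentry, Finset.sum_add_distrib, Finset.sum_ite_eq', Finset.mem_univ, if_true,
    Finset.sum_const, Finset.card_univ, Fintype.card_fin, nsmul_eq_mul]
  field_simp
  ring

theorem matrix_smul_const (M : Matrix (Fin n) (Fin n) ℝ) (v : Vec r) :
    M • Function.const (Fin n) v = fun i => (∑ j, M i j) • v := by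
  ext1 i
  simp [Matrix.Module.smul_apply, Finset.sum_smul]

theorem avgMatrix_smul (z : Fin n → Vec r) :
    avgMatrix n • z = Function.const _ (agentAvg z) := by
  ext1 i
  simp [Matrix.Module.smul_apply, avgMatrix, agentAvg, Finset.smul_sum]

variable {W : Matrix (Fin n) (Fin n) ℝ}

theorem agentAvg_matrix_smul (hsymm : W.IsSymm) (hrow : ∀ i, ∑ j, W i j = 1)
    (z : Fin n → Vec r) : agentAvg (W • z) = agentAvg z := by
  simp only [agentAvg, Matrix.Module.smul_apply]
  rw [Finset.sum_comm]
  simp only [← Finset.sum_smul, ← hsymm.apply _, hrow, one_smul]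

theorem consensusSq_matrix_smul_le (hn : 0 < n) (hsymm : W.IsSymm) (hrow : ∀ i, ∑ j, W i j = 1)
    (z : Fin n → Vec r) : consensusSq (W • z) ≤ rhoW W ^ 2 * consensusSq z := by
  have hherm : (W - avgMatrix n).IsHermitian :=
    Matrix.IsHermitian.ext fun i j => by simp [avgMatrix, hsymm.apply i j]
  have hone : ∀ i, ∑ j, (W - avgMatrix n) i j = 0 := fun i => by
    have h0 : (n : ℝ) ≠ 0 := by positivity
    simp [avgMatrix, hrow, h0]
  have hdev : W • z - Function.const _ (agentAvg (W • z))
      = (W - avgMatrix n) • (z - Function.const _ (agentAvg z)) := by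
    rw [smul_sub, matrix_smul_const, sub_smul, avgMatrix_smul, agentAvg_matrix_smul hsymm hrow]
    simp only [hone, zero_smul]
    exact (sub_zero _).symm
  rw [consensusSq_eq_stackNormSq, hdev]
  exact stackNormSq_matrix_smul_le_spectralRadius hherm _

theorem stackNormSq_matrix_smul_sub_self_le (hn : 0 < n) (hsymm : W.IsSymm)
    (hrow : ∀ i, ∑ j, W i j = 1) (hρ : rhoW W ^ 2 ≤ 1) (z : Fin n → Vec r) :
    stackNormSq (W • z - z) ≤ 4 * consensusSq z := by
  have havg : agentAvg (W • z) = agentAvg z := agentAvg_matrix_smul hsymm hrow z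
  have hdev : W • z - z = (W • z - Function.const _ (agentAvg (W • z)))
      - (z - Function.const _ (agentAvg z)) := by rw [havg]; abel
  have hW : consensusSq (W • z) ≤ consensusSq z :=
    (consensusSq_matrix_smul_le hn hsymm hrow z).trans
      (mul_le_of_le_one_left (consensusSq_nonneg z) hρ)
  have hyoung := stackNormSq_sub_le one_pos (W • z - Function.const _ (agentAvg (W • z)))
    (z - Function.const _ (agentAvg z))
  rw [← hdev, ← consensusSq_eq_stackNormSq, ← consensusSq_eq_stackNormSq] at hyoung
  linarith

end Average

/-! ### The global objective -/

section Objective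

variable {n r : ℕ} {f : Fin n → Vec r → ℝ} {μ L : ℝ}

/-- The local gradients `∇fᵢ(xᵢ)`, each agent evaluating its own objective at its own decision. -/
noncomputable def gradStack (f : Fin n → Vec r → ℝ) (x : Fin n → Vec r) : Fin n → Vec r :=
  fun i => gradient (f i) (x i)

theorem stackNormSq_gradStack_sub_le (hf : ∀ i, HasLipschitzGradient L (f i))
    (x x' : Fin n → Vec r) :
    stackNormSq (gradStack f x - gradStack f x') ≤ L ^ 2 * stackNormSq (x - x') := by
  rw [stackNormSq, stackNormSq, Finset.mul_sum]
  simp only [← mul_pow]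
  exact Finset.sum_le_sum fun i _ =>
    pow_le_pow_left₀ (norm_nonneg _) ((hf i).norm_gradient_sub_le (x i) (x' i)) 2

theorem gradient_globalObj (hf : ∀ i, Differentiable ℝ (f i)) (x : Vec r) :
    gradient (globalObj f) x = agentAvg (gradStack f (Function.const _ x)) := by
  have hfderiv : fderiv ℝ (globalObj f) x = (1 / (n : ℝ)) • ∑ i, fderiv ℝ (f i) x :=
    ((HasFDerivAt.fun_sum fun i _ => (hf i x).hasFDerivAt).const_mul (1 / (n : ℝ))).fderiv
  simp [gradient, hfderiv, agentAvg, gradStack]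

theorem differentiable_globalObj (hf : ∀ i, Differentiable ℝ (f i)) :
    Differentiable ℝ (globalObj f) :=
  (Differentiable.fun_sum fun i _ => hf i).const_mul (1 / (n : ℝ))

theorem norm_agentAvg_gradStack_sub_sq_le (hn : 0 < n) (hf : ∀ i, HasLipschitzGradient L (f i))
    (x x' : Fin n → Vec r) :
    n * ‖agentAvg (gradStack f x) - agentAvg (gradStack f x')‖ ^ 2
      ≤ L ^ 2 * stackNormSq (x - x') := by
  rw [← agentAvg_sub]
  exact (mul_norm_agentAvg_sq_le_stackNormSq hn _).trans (stackNormSq_gradStack_sub_le hf x x')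

theorem norm_agentAvg_gradStack_sub_gradient_sq_le (hn : 0 < n)
    (hf : ∀ i, HasLipschitzGradient L (f i)) (x : Fin n → Vec r) :
    n * ‖agentAvg (gradStack f x) - gradient (globalObj f) (agentAvg x)‖ ^ 2
      ≤ L ^ 2 * consensusSq x := by
  rw [gradient_globalObj fun i => (hf i).differentiable]
  exact norm_agentAvg_gradStack_sub_sq_le hn hf x _

theorem hasLipschitzGradient_globalObj (hn : 0 < n) (hL : 0 ≤ L)
    (hf : ∀ i, HasLipschitzGradient L (f i)) : HasLipschitzGradient L (globalObj f) where
  differentiable := differentiable_globalObj fun i => (hf i).differentiable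
  norm_gradient_sub_le x x' := by
    have hn' : (0 : ℝ) < n := Nat.cast_pos.2 hn
    have h := norm_agentAvg_gradStack_sub_sq_le hn hf (Function.const _ x) (Function.const _ x')
    have hconst : stackNormSq (Function.const (Fin n) x - Function.const (Fin n) x')
        = n * ‖x - x'‖ ^ 2 :=
      (stackNormSq_const (ι := Fin n) (x - x')).trans (by rw [Fintype.card_fin])
    rw [hconst, ← gradient_globalObj fun i => (hf i).differentiable,
      ← gradient_globalObj fun i => (hf i).differentiable, mul_left_comm, ← mul_pow] at h
    exact le_of_sq_le_sq (le_of_mul_le_mul_left h hn') (by positivity)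

theorem hasStronglyMonotoneGradient_globalObj (hn : 0 < n) (hdiff : ∀ i, Differentiable ℝ (f i))
    (hf : ∀ i, HasStronglyMonotoneGradient μ (f i)) :
    HasStronglyMonotoneGradient μ (globalObj f) := fun x x' => by
  have hn' : (n : ℝ) ≠ 0 := by positivity
  have hsum : ∑ _i : Fin n, μ * ‖x - x'‖ ^ 2
      ≤ ∑ i, inner ℝ (gradient (f i) x - gradient (f i) x') (x - x') :=
    Finset.sum_le_sum fun i _ => hf i x x'
  calc μ * ‖x - x'‖ ^ 2
      = 1 / (n : ℝ) * ∑ _i : Fin n, μ * ‖x - x'‖ ^ 2 := by simp [hn']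
    _ ≤ 1 / (n : ℝ) * ∑ i, inner ℝ (gradient (f i) x - gradient (f i) x') (x - x') := by gcongr
    _ = inner ℝ (gradient (globalObj f) x - gradient (globalObj f) x') (x - x') := by
      rw [gradient_globalObj hdiff, gradient_globalObj hdiff, ← agentAvg_sub, agentAvg,
        real_inner_smul_left, sum_inner]
      rfl

theorem ObjectiveAssumption.hasLipschitzGradient (hf : ObjectiveAssumption f μ L) (i : Fin n) :
    HasLipschitzGradient L (f i) :=
  ⟨hf.differentiable i, hf.lipschitz i⟩

end Objective

/-! ### Contraction of the noiseless iteration -/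

section Contraction

theorem HasLipschitzGradient.inexact_gradient_step_le {E : Type*} [NormedAddCommGroup E]
    [InnerProductSpace ℝ E] [CompleteSpace E] {g : E → ℝ} {L : ℝ} (hg : HasLipschitzGradient L g)
    (h : ℝ) (x v : E) :
    g (x - h • v) ≤ g x - h / 2 * ‖gradient g x‖ ^ 2 - h / 2 * (1 - h * L) * ‖v‖ ^ 2
      + h / 2 * ‖v - gradient g x‖ ^ 2 := by
  have hquad := hg.le_quadratic x (-(h • v))
  have hpolar := norm_sub_sq_real v (gradient g x)
  rw [real_inner_comm] at hpolar
  rw [← sub_eq_add_neg, inner_neg_right, real_inner_smul_right, norm_neg, norm_smul, mul_pow,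
    Real.norm_eq_abs, sq_abs] at hquad
  linear_combination hquad - h / 2 * hpolar

variable {n r : ℕ}

/-- One step of the noiseless algorithm for the decision variables, in terms of the gradient
trackers `z`. -/
def xNext (W : Matrix (Fin n) (Fin n) ℝ) (α : ℝ) (x z : Fin n → Vec r) : Fin n → Vec r :=
  W • x - α • z

/-- One step of the noiseless algorithm for the gradient trackers. -/
noncomputable def zNext (W : Matrix (Fin n) (Fin n) ℝ) (f : Fin n → Vec r → ℝ) (α γ : ℝ)
    (x z : Fin n → Vec r) : Fin n → Vec r :=
  W • z + γ • (gradStack f (xNext W α x z) - gradStack f x)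

/-- The Lyapunov function: a weighted sum of the optimality gap of the average decision and of the
two consensus errors. -/
noncomputable def lyapunov (A c : ℝ) (f : Fin n → Vec r → ℝ) (xstar : Vec r)
    (x z : Fin n → Vec r) : ℝ :=
  A * (globalObj f (agentAvg x) - globalObj f xstar) + consensusSq x + c * consensusSq z

/-- The condition on the step size `h = αγ` under which the noiseless algorithm contracts. A single
agent performs plain gradient descent, for which the classical bound `h < 2 / L` is enough. -/
def StableStepsize (W : Matrix (Fin n) (Fin n) ℝ) (L h : ℝ) : Prop :=
  n = 1 ∧ h * L < 2 ∨
    rhoW W ^ 2 < 1 ∧ 64 * (1 + rhoW W ^ 2) * (h * L) ^ 2 ≤ (1 - rhoW W ^ 2) ^ 4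

variable {W : Matrix (Fin n) (Fin n) ℝ} {f : Fin n → Vec r → ℝ} {μ L α γ : ℝ} {xstar : Vec r}
  {x z : Fin n → Vec r}

theorem agentAvg_xNext (hsymm : W.IsSymm) (hrow : ∀ i, ∑ j, W i j = 1)
    (hz : agentAvg z = γ • agentAvg (gradStack f x)) :
    agentAvg (xNext W α x z) = agentAvg x - (α * γ) • agentAvg (gradStack f x) := by
  rw [xNext, agentAvg_sub, agentAvg_matrix_smul hsymm hrow, agentAvg_smul, hz, smul_smul]

theorem gap_xNext_le (hn : 0 < n) (hsymm : W.IsSymm) (hrow : ∀ i, ∑ j, W i j = 1)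
    (hf : ∀ i, HasLipschitzGradient L (f i)) (hmono : HasStronglyMonotoneGradient μ (globalObj f))
    (hμ : 0 ≤ μ) (hL : 0 ≤ L) (hh : 0 ≤ α * γ) (hz : agentAvg z = γ • agentAvg (gradStack f x)) :
    n * (globalObj f (agentAvg (xNext W α x z)) - globalObj f xstar)
      ≤ (1 - α * γ * μ) * (n * (globalObj f (agentAvg x) - globalObj f xstar))
        - α * γ / 2 * (1 - α * γ * L) * (n * ‖agentAvg (gradStack f x)‖ ^ 2)
        + α * γ / 2 * (L ^ 2 * consensusSq x) := by
  have hglobal := hasLipschitzGradient_globalObj hn hL hf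
  have hstep := hglobal.inexact_gradient_step_le (α * γ) (agentAvg x) (agentAvg (gradStack f x))
  have hPL := hmono.mul_sub_le_norm_gradient_sq hglobal.differentiable hμ (agentAvg x) xstar
  have herr := norm_agentAvg_gradStack_sub_gradient_sq_le hn hf x
  rw [agentAvg_xNext hsymm hrow hz]
  linear_combination (n : ℝ) * hstep + n * (α * γ) / 2 * hPL + α * γ / 2 * herr

theorem consensusSq_xNext_le (hn : 0 < n) (hsymm : W.IsSymm) (hrow : ∀ i, ∑ j, W i j = 1)
    (hρ : rhoW W ^ 2 < 1) :
    consensusSq (xNext W α x z) ≤ (1 + rhoW W ^ 2) / 2 * consensusSq x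
      + (1 + rhoW W ^ 2) / (1 - rhoW W ^ 2) * (α ^ 2 * consensusSq z) := by
  rw [xNext, sub_eq_add_neg, ← neg_smul, ← neg_sq α, ← consensusSq_smul]
  exact consensusSq_add_le_of_contraction (sq_nonneg _) hρ (consensusSq_nonneg x)
    (consensusSq_matrix_smul_le hn hsymm hrow x) _

theorem stackNormSq_xNext_sub_le (hn : 0 < n) (hsymm : W.IsSymm) (hrow : ∀ i, ∑ j, W i j = 1)
    (hρ : rhoW W ^ 2 ≤ 1) (hz : agentAvg z = γ • agentAvg (gradStack f x)) :
    stackNormSq (xNext W α x z - x) ≤ 5 * consensusSq x + 5 * (α ^ 2 * consensusSq z)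
      + 5 * ((α * γ) ^ 2 * (n * ‖agentAvg (gradStack f x)‖ ^ 2)) := by
  have hsplit : xNext W α x z - x = (W • x - x) - α • z := by rw [xNext]; abel
  have hyoung := stackNormSq_sub_le (c := 1 / 4) (by norm_num) (W • x - x) (α • z)
  have hWx := stackNormSq_matrix_smul_sub_self_le hn hsymm hrow hρ x
  rw [stackNormSq_smul, stackNormSq_eq_consensusSq_add hn z, hz, norm_smul, mul_pow,
    Real.norm_eq_abs, sq_abs] at hyoung
  rw [hsplit]
  linear_combination hyoung + 5 / 4 * hWx

theorem consensusSq_zNext_le (hn : 0 < n) (hsymm : W.IsSymm) (hrow : ∀ i, ∑ j, W i j = 1)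
    (hf : ∀ i, HasLipschitzGradient L (f i)) (hρ : rhoW W ^ 2 < 1)
    (hz : agentAvg z = γ • agentAvg (gradStack f x)) :
    α ^ 2 * consensusSq (zNext W f α γ x z)
      ≤ (1 + rhoW W ^ 2) / 2 * (α ^ 2 * consensusSq z)
        + (1 + rhoW W ^ 2) / (1 - rhoW W ^ 2) * ((α * γ * L) ^ 2
          * (5 * consensusSq x + 5 * (α ^ 2 * consensusSq z)
            + 5 * ((α * γ) ^ 2 * (n * ‖agentAvg (gradStack f x)‖ ^ 2)))) := by
  have := sub_pos.2 hρ
  have hyoung := consensusSq_add_le_of_contraction (sq_nonneg _) hρ (consensusSq_nonneg z)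
    (consensusSq_matrix_smul_le hn hsymm hrow z) (γ • (gradStack f (xNext W α x z) - gradStack f x))
  have hgrad : consensusSq (γ • (gradStack f (xNext W α x z) - gradStack f x))
      ≤ γ ^ 2 * (L ^ 2 * stackNormSq (xNext W α x z - x)) := by
    rw [consensusSq_smul]
    gcongr
    exact (consensusSq_le_stackNormSq hn _).trans (stackNormSq_gradStack_sub_le hf _ _)
  calc α ^ 2 * consensusSq (zNext W f α γ x z)
      ≤ α ^ 2 * ((1 + rhoW W ^ 2) / 2 * consensusSq z + (1 + rhoW W ^ 2) / (1 - rhoW W ^ 2)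
          * (γ ^ 2 * (L ^ 2 * stackNormSq (xNext W α x z - x)))) := by
        gcongr
        exact hyoung.trans (by gcongr)
    _ = (1 + rhoW W ^ 2) / 2 * (α ^ 2 * consensusSq z) + (1 + rhoW W ^ 2) / (1 - rhoW W ^ 2)
          * ((α * γ * L) ^ 2 * stackNormSq (xNext W α x z - x)) := by ring
    _ ≤ _ := by
        gcongr
        exact stackNormSq_xNext_sub_le hn hsymm hrow hρ.le hz

theorem scaled_gap_le {δ κ h L μ N N' X G : ℝ} (hδ : 0 ≤ δ) (hκ : κ ≤ h * μ) (hh : 0 < h)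
    (hL : 0 < L) (hhL : h * L ≤ 1 / 8) (hN : 0 ≤ N) (hG : 0 ≤ G)
    (hN' : N' ≤ (1 - h * μ) * N - h / 2 * (1 - h * L) * G + h / 2 * (L ^ 2 * X)) :
    δ / (10 * h * L ^ 2) * N' ≤ (1 - κ) * (δ / (10 * h * L ^ 2) * N) + δ / 20 * X
      - 7 * δ / 160 * (G / L ^ 2) := by
  have hdescent : 0 ≤ δ / 20 * (1 / 8 - h * L) * (G / L ^ 2) := by
    have := sub_nonneg.2 hhL
    positivity
  have hrate : (1 - h * μ) * (δ / (10 * h * L ^ 2) * N) ≤ (1 - κ) * (δ / (10 * h * L ^ 2) * N) := by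
    gcongr
  calc δ / (10 * h * L ^ 2) * N'
      ≤ δ / (10 * h * L ^ 2)
          * ((1 - h * μ) * N - h / 2 * (1 - h * L) * G + h / 2 * (L ^ 2 * X)) := by gcongr
    _ = (1 - h * μ) * (δ / (10 * h * L ^ 2) * N) + δ / 20 * X
          - δ / 20 * (1 - h * L) * (G / L ^ 2) := by field_simp; ring
    _ ≤ _ := by linear_combination hdescent + hrate

theorem scaled_tracker_le {δ s t X v v' g : ℝ} (hδ : 0 < δ) (hδ1 : δ ≤ 1) (hs : s = 2 - δ)
    (ht : 64 * s * t ^ 2 ≤ δ ^ 4) (hX : 0 ≤ X) (hv : 0 ≤ v) (hg : 0 ≤ g)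
    (hv' : v' ≤ s / 2 * v + s / δ * (t ^ 2 * (5 * X + 5 * v + 5 * (t ^ 2 * g)))) :
    s / δ ^ 2 * v' ≤ (1 - δ / 2) * (s / δ ^ 2 * v) + 5 * δ / 32 * X
      + 5 * δ / 64 * (s / δ ^ 2 * v) + 5 * δ / 2048 * g := by
  have hs1 : 1 ≤ s := by linarith
  have hst : s * t ^ 2 / δ ≤ δ / 64 := by
    rw [div_le_iff₀ hδ]
    linarith [pow_le_pow_of_le_one hδ.le hδ1 (show 2 ≤ 4 by norm_num)]
  have hsst : s ^ 2 * t ^ 2 / δ ^ 3 ≤ δ / 32 := by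
    rw [div_le_iff₀ (by positivity)]
    linarith [mul_le_mul_of_nonneg_left ht (zero_le_one.trans hs1),
      mul_le_mul_of_nonneg_right (show s ≤ 2 by linarith) (pow_nonneg hδ.le 4)]
  have ht1 : t ^ 2 ≤ 1 / 64 := by
    linarith [mul_le_mul_of_nonneg_right hs1 (sq_nonneg t), pow_le_one₀ hδ.le hδ1 (n := 4)]
  calc s / δ ^ 2 * v'
      ≤ s / δ ^ 2 * (s / 2 * v + s / δ * (t ^ 2 * (5 * X + 5 * v + 5 * (t ^ 2 * g)))) := by
        gcongr
    _ = s / 2 * (s / δ ^ 2 * v) + 5 * (s ^ 2 * t ^ 2 / δ ^ 3) * X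
          + 5 * (s * t ^ 2 / δ) * (s / δ ^ 2 * v)
          + 5 * (s ^ 2 * t ^ 2 / δ ^ 3) * t ^ 2 * g := by field_simp; ring
    _ ≤ s / 2 * (s / δ ^ 2 * v) + 5 * (δ / 32) * X + 5 * (δ / 64) * (s / δ ^ 2 * v)
          + 5 * (δ / 32) * (1 / 64) * g := by gcongr
    _ = _ := by rw [hs]; ring

theorem lyapunov_combination {δ κ M M' X X' U U' g : ℝ} (hδ : 0 ≤ δ) (hκ : κ ≤ δ / 50)
    (hX : 0 ≤ X) (hU : 0 ≤ U) (hg : 0 ≤ g)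
    (hM' : M' ≤ (1 - κ) * M + δ / 20 * X - 7 * δ / 160 * g)
    (hX' : X' ≤ (1 - δ / 2) * X + δ * U)
    (hU' : U' ≤ (1 - δ / 2) * U + 5 * δ / 32 * X + 5 * δ / 64 * U + 5 * δ / 2048 * g) :
    M' + X' + 5 / 2 * U' ≤ (1 - κ) * (M + X + 5 / 2 * U) := by
  have hκX : κ * X ≤ δ / 50 * X := by gcongr
  have hκU : κ * U ≤ δ / 50 * U := by gcongr
  have hδX : 0 ≤ δ * X := by positivity
  have hδU : 0 ≤ δ * U := by positivity
  have hδg : 0 ≤ δ * g := by positivity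
  linarith

theorem lyapunov_step_scalar {δ s κ h L μ N N' X X' v v' G : ℝ} (hδ : 0 < δ) (hδ1 : δ ≤ 1)
    (hs : s = 2 - δ) (hκδ : κ ≤ δ / 50) (hκμ : κ ≤ h * μ) (hh : 0 < h) (hL : 0 < L)
    (ht : 64 * s * (h * L) ^ 2 ≤ δ ^ 4) (hN : 0 ≤ N) (hX : 0 ≤ X) (hv : 0 ≤ v) (hG : 0 ≤ G)
    (hN' : N' ≤ (1 - h * μ) * N - h / 2 * (1 - h * L) * G + h / 2 * (L ^ 2 * X))
    (hX' : X' ≤ s / 2 * X + s / δ * v)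
    (hv' : v' ≤ s / 2 * v + s / δ * ((h * L) ^ 2 * (5 * X + 5 * v + 5 * (h ^ 2 * G)))) :
    δ / (10 * h * L ^ 2) * N' + X' + 5 / 2 * (s / δ ^ 2 * v')
      ≤ (1 - κ) * (δ / (10 * h * L ^ 2) * N + X + 5 / 2 * (s / δ ^ 2 * v)) := by
  have hs1 : 1 ≤ s := by linarith
  have hhL : h * L ≤ 1 / 8 := by
    refine le_of_sq_le_sq ?_ (by norm_num)
    linarith [mul_le_mul_of_nonneg_right hs1 (sq_nonneg (h * L)), pow_le_one₀ hδ.le hδ1 (n := 4)]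
  have hX'' : X' ≤ (1 - δ / 2) * X + δ * (s / δ ^ 2 * v) := by
    refine hX'.trans_eq ?_
    rw [hs]
    field_simp
  rw [show h ^ 2 * G = (h * L) ^ 2 * (G / L ^ 2) by field_simp] at hv'
  exact lyapunov_combination hδ.le hκδ hX (by positivity) (by positivity)
    (scaled_gap_le hδ.le hκμ hh hL hhL hN hG hN') hX''
    (scaled_tracker_le hδ hδ1 hs ht hX hv (by positivity) hv')

theorem exists_lyapunov_contraction_of_card_eq_one (hn1 : n = 1) (hsymm : W.IsSymm)
    (hrow : ∀ i, ∑ j, W i j = 1) (hf : ∀ i, HasLipschitzGradient L (f i))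
    (hmono : HasStronglyMonotoneGradient μ (globalObj f)) (hμ : 0 < μ) (hL : 0 ≤ L)
    (hxstar : ∀ x, globalObj f xstar ≤ globalObj f x) (hh : 0 < α * γ) (hstep : α * γ * L < 2) :
    ∃ A c lam : ℝ, 0 < A ∧ 0 < c ∧ 0 < lam ∧ lam < 1 ∧ ∀ x z : Fin n → Vec r,
      agentAvg z = γ • agentAvg (gradStack f x) →
        lyapunov A c f xstar (xNext W α x z) (zNext W f α γ x z)
          ≤ lam * lyapunov A c f xstar x z := by
  subst hn1
  have hrate : 0 < α * γ * μ * (2 - α * γ * L) := mul_pos (by positivity) (by linarith)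
  have hcons : ∀ z : Fin 1 → Vec r, consensusSq z = 0 := fun z => by simp [consensusSq, agentAvg]
  refine ⟨1, 1, max (1 / 2) (1 - α * γ * μ * (2 - α * γ * L)), one_pos, one_pos,
    lt_max_of_lt_left (by norm_num), max_lt (by norm_num) (by linarith), fun x z hz => ?_⟩
  have hglobal := hasLipschitzGradient_globalObj one_pos hL hf
  have hgrad : agentAvg (gradStack f x) = gradient (globalObj f) (agentAvg x) := by
    have h := norm_agentAvg_gradStack_sub_gradient_sq_le one_pos hf x
    rw [hcons, mul_zero, Nat.cast_one, one_mul] at h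
    exact sub_eq_zero.1 (norm_eq_zero.1 (pow_eq_zero_iff two_ne_zero |>.1
      (le_antisymm h (sq_nonneg _))))
  have hdescent := hglobal.inexact_gradient_step_le (α * γ) (agentAvg x)
    (gradient (globalObj f) (agentAvg x))
  rw [sub_self, norm_zero] at hdescent
  have hPL := hmono.mul_sub_le_norm_gradient_sq hglobal.differentiable hμ.le (agentAvg x) xstar
  have hPL' := mul_le_mul_of_nonneg_left hPL
    (show 0 ≤ α * γ / 2 * (2 - α * γ * L) from mul_nonneg (by positivity) (by linarith))
  simp only [lyapunov, hcons, agentAvg_xNext hsymm hrow hz, hgrad, one_mul, mul_zero, add_zero]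
  calc _ ≤ (1 - α * γ * μ * (2 - α * γ * L))
        * (globalObj f (agentAvg x) - globalObj f xstar) := by
        linear_combination hdescent + hPL'
    _ ≤ _ := mul_le_mul_of_nonneg_right (le_max_right _ _) (sub_nonneg.2 (hxstar _))

theorem exists_lyapunov_contraction_of_rhoW (hn : 0 < n) (hsymm : W.IsSymm)
    (hrow : ∀ i, ∑ j, W i j = 1) (hf : ∀ i, HasLipschitzGradient L (f i))
    (hmono : HasStronglyMonotoneGradient μ (globalObj f)) (hμ : 0 < μ) (hL : 0 < L)
    (hxstar : ∀ x, globalObj f xstar ≤ globalObj f x) (hα : 0 < α) (hγ : 0 < γ)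
    (hρ : rhoW W ^ 2 < 1)
    (hstep : 64 * (1 + rhoW W ^ 2) * (α * γ * L) ^ 2 ≤ (1 - rhoW W ^ 2) ^ 4) :
    ∃ A c lam : ℝ, 0 < A ∧ 0 < c ∧ 0 < lam ∧ lam < 1 ∧ ∀ x z : Fin n → Vec r,
      agentAvg z = γ • agentAvg (gradStack f x) →
        lyapunov A c f xstar (xNext W α x z) (zNext W f α γ x z)
          ≤ lam * lyapunov A c f xstar x z := by
  set κ := min (α * γ * μ) ((1 - rhoW W ^ 2) / 50)
  have hδ : 0 < 1 - rhoW W ^ 2 := sub_pos.2 hρ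
  have hδ1 : 1 - rhoW W ^ 2 ≤ 1 := sub_le_self _ (sq_nonneg _)
  have hκ : 0 < κ := lt_min (by positivity) (by positivity)
  have hκδ : κ ≤ (1 - rhoW W ^ 2) / 50 := min_le_right _ _
  refine ⟨(1 - rhoW W ^ 2) / (10 * (α * γ) * L ^ 2) * n,
    5 / 2 * ((1 + rhoW W ^ 2) / (1 - rhoW W ^ 2) ^ 2 * α ^ 2), 1 - κ, by positivity,
    by positivity, by linarith, by linarith, fun x z hz => ?_⟩
  have hstep := lyapunov_step_scalar hδ hδ1 (by ring) hκδ (min_le_left _ _) (by positivity) hL hstep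
    (mul_nonneg (Nat.cast_nonneg _) (sub_nonneg.2 (hxstar _))) (consensusSq_nonneg x)
    (mul_nonneg (sq_nonneg α) (consensusSq_nonneg z)) (by positivity)
    (gap_xNext_le hn hsymm hrow hf hmono hμ.le hL.le (by positivity) hz)
    (consensusSq_xNext_le hn hsymm hrow hρ) (consensusSq_zNext_le hn hsymm hrow hf hρ hz)
  simp only [lyapunov]
  linear_combination hstep

theorem exists_lyapunov_contraction (hn : 0 < n) (hsymm : W.IsSymm)
    (hrow : ∀ i, ∑ j, W i j = 1) (hf : ∀ i, HasLipschitzGradient L (f i))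
    (hmono : HasStronglyMonotoneGradient μ (globalObj f)) (hμ : 0 < μ) (hL : 0 < L)
    (hxstar : ∀ x, globalObj f xstar ≤ globalObj f x) (hα : 0 < α) (hγ : 0 < γ)
    (hstep : StableStepsize W L (α * γ)) :
    ∃ A c lam : ℝ, 0 < A ∧ 0 < c ∧ 0 < lam ∧ lam < 1 ∧ ∀ x z : Fin n → Vec r,
      agentAvg z = γ • agentAvg (gradStack f x) →
        lyapunov A c f xstar (xNext W α x z) (zNext W f α γ x z)
          ≤ lam * lyapunov A c f xstar x z := by
  rcases hstep with ⟨hn1, hstep⟩ | ⟨hρ, hstep⟩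
  · exact exists_lyapunov_contraction_of_card_eq_one hn1 hsymm hrow hf hmono hμ hL.le hxstar
      (by positivity) hstep
  · exact exists_lyapunov_contraction_of_rhoW hn hsymm hrow hf hmono hμ hL hxstar hα hγ hρ hstep

theorem le_c42 (hn : 1 < n) (hμ : 0 < μ) (hL : 0 < L) (hρ : 0 < 1 - rhoW W ^ 2) :
    64 * (1 + rhoW W ^ 2) * L ^ 2 / (1 - rhoW W ^ 2) ^ 4 ≤ c42 W μ L := by
  have hd : 1 ≤ dI n ^ 2 := by
    have : (2 : ℝ) ≤ n := by exact_mod_cast hn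
    rw [dI_sq (one_pos.trans hn)]
    linarith
  have hfactor : (μ + L) ^ 2 ≤ (μ ^ 2 + 2 * μ * L + 5 * L ^ 2) * dI n ^ 2 :=
    (show (μ + L) ^ 2 ≤ μ ^ 2 + 2 * μ * L + 5 * L ^ 2 by linarith [sq_nonneg L]).trans
      (le_mul_of_one_le_right (by positivity) hd)
  rw [c42, div_le_div_iff₀ (by positivity) (by positivity)]
  linarith [mul_le_mul_of_nonneg_left hfactor
    (show 0 ≤ 64 * (1 + rhoW W ^ 2) * L ^ 2 * (1 - rhoW W ^ 2) ^ 4 by positivity)]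

theorem StepsizeCondition.stableStepsize (hn : 0 < n) (hμ : 0 < μ) (hL : 0 < L)
    (hh : 0 < α * γ) (h : StepsizeCondition W μ L α γ) : StableStepsize W L (α * γ) := by
  rcases (Nat.succ_le_of_lt hn).eq_or_lt with hn1 | hn1
  · have := (lt_div_iff₀ (by positivity)).1 h.1
    exact Or.inl ⟨hn1.symm, by linarith [mul_pos hh hμ]⟩
  obtain ⟨hsecond, hthird⟩ := h.2 hn1
  have hρ : 0 < 1 - rhoW W ^ 2 := by
    by_contra hneg
    refine (hh.trans hsecond).not_ge (div_nonpos_of_nonpos_of_nonneg (not_lt.1 hneg) ?_)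
    exact mul_nonneg (by positivity) (Real.sqrt_nonneg _)
  have hc41 : 0 ≤ c41 W μ L := by rw [c41]; positivity
  have hc42 := le_c42 hn1 hμ hL hρ
  have hc42_pos : 0 < c42 W μ L := lt_of_lt_of_le (by positivity) hc42
  have hsqrt : c42 W μ L ≤ √(c42 W μ L ^ 2 + 4 * c41 W μ L) :=
    Real.le_sqrt_of_sq_le (by linarith)
  have hh2 : (α * γ) ^ 2 * c42 W μ L ≤ 1 := by
    have h2 := (Real.lt_sqrt hh.le).1 hthird
    rw [lt_div_iff₀ (by positivity)] at h2
    linarith [mul_le_mul_of_nonneg_left hsqrt (sq_nonneg (α * γ))]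
  have hle := (mul_le_mul_of_nonneg_left hc42 (sq_nonneg (α * γ))).trans hh2
  rw [mul_div_assoc', div_le_one (by positivity)] at hle
  exact Or.inr ⟨sub_pos.1 hρ, by linarith⟩

end Contraction

/-! ### The noisy iteration along a sample path -/

section Pathwise

variable {n r : ℕ} {W : Matrix (Fin n) (Fin n) ℝ} {f : Fin n → Vec r → ℝ} {μ L α γ : ℝ}
  {xstar : Vec r}

theorem lyapunov_nonneg {A c : ℝ} (hA : 0 ≤ A) (hc : 0 ≤ c)
    (hxstar : ∀ x, globalObj f xstar ≤ globalObj f x) (x z : Fin n → Vec r) :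
    0 ≤ lyapunov A c f xstar x z :=
  add_nonneg (add_nonneg (mul_nonneg hA (sub_nonneg.2 (hxstar _))) (consensusSq_nonneg x))
    (mul_nonneg hc (consensusSq_nonneg z))

theorem exists_lyapunov_add_le (hn : 0 < n) (hf : ∀ i, HasLipschitzGradient L (f i))
    (hmono : HasStronglyMonotoneGradient μ (globalObj f)) (hμ : 0 < μ) (hL : 0 < L)
    (hxstar : ∀ x, globalObj f xstar ≤ globalObj f x) {A c ε : ℝ} (hA : 0 < A) (hc : 0 < c)
    (hε : 0 < ε) :
    ∃ B, 0 < B ∧ ∀ x z u w : Fin n → Vec r, lyapunov A c f xstar (x + u) (z + w)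
      ≤ (1 + ε) * lyapunov A c f xstar x z + B * (stackNormSq u + stackNormSq w) := by
  obtain ⟨K, hK, hgap⟩ :=
    exists_gap_add_le (hasLipschitzGradient_globalObj hn hL.le hf) hmono hμ hL hxstar hε
  refine ⟨A * K + (1 + 1 / ε) * (1 + c), by positivity, fun x z u w => ?_⟩
  have havg : ‖agentAvg u‖ ^ 2 ≤ stackNormSq u :=
    (le_mul_of_one_le_left (sq_nonneg _) (Nat.one_le_cast.2 hn)).trans
      (mul_norm_agentAvg_sq_le_stackNormSq hn u)
  have hu := stackNormSq_nonneg u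
  have hw := stackNormSq_nonneg w
  have hgap' := (hgap (agentAvg x) (agentAvg u)).trans
    (add_le_add_right (mul_le_mul_of_nonneg_left havg hK.le) _)
  have hx := consensusSq_add_le hn hε x u
  have hz := consensusSq_add_le hn hε z w
  have hslack : 0 ≤ (1 + 1 / ε) * c * stackNormSq u + (A * K + (1 + 1 / ε)) * stackNormSq w := by
    positivity
  simp only [lyapunov, agentAvg_add]
  linear_combination A * hgap' + hx + c * hz + hslack

/-- The part of the coupling matrix that carries the noise: agents receive their own variables
exactly. -/
def offDiag (W : Matrix (Fin n) (Fin n) ℝ) : Matrix (Fin n) (Fin n) ℝ :=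
  W - Matrix.diagonal fun i => W i i

/-- The noiseless increment of the tracking variables `s` at the state `(s, x)`; the trackers `y_k`
are perturbations of it. -/
noncomputable def tracker (W : Matrix (Fin n) (Fin n) ℝ) (f : Fin n → Vec r → ℝ) (γ : ℝ)
    (s x : Fin n → Vec r) : Fin n → Vec r :=
  W • s - s + γ • gradStack f x

theorem agentAvg_tracker (hsymm : W.IsSymm) (hrow : ∀ i, ∑ j, W i j = 1) (s x : Fin n → Vec r) :
    agentAvg (tracker W f γ s x) = γ • agentAvg (gradStack f x) := by
  rw [tracker, agentAvg_add, agentAvg_sub, agentAvg_matrix_smul hsymm hrow, sub_self, zero_add,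
    agentAvg_smul]

theorem tracker_succ (s e x x' : Fin n → Vec r) :
    tracker W f γ (s + tracker W f γ s x + e) x'
      = zNext W f α γ x (tracker W f γ s x)
        + (γ • (gradStack f x' - gradStack f (xNext W α x (tracker W f γ s x)))
          + (W • e - e)) := by
  simp only [tracker, zNext, smul_add, smul_sub]
  abel

theorem noisy_mixing_eq (s ζ : Fin n → Vec r) (b : ℝ) (i : Fin n) :
    W i i • s i + ∑ j ∈ Finset.univ.erase i, W i j • (s j + b • ζ j)
      = (W • s + b • (offDiag W • ζ)) i := by
  have hζ : (offDiag W • ζ) i = ∑ j ∈ Finset.univ.erase i, W i j • ζ j := by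
    rw [offDiag, sub_smul, Pi.sub_apply, Matrix.Module.smul_apply,
      ← Finset.add_sum_erase _ _ (Finset.mem_univ i)]
    simp [Matrix.Module.smul_apply, Matrix.diagonal_apply]
  rw [Pi.add_apply, Pi.smul_apply, hζ, Matrix.Module.smul_apply,
    ← Finset.add_sum_erase _ _ (Finset.mem_univ i)]
  simp only [smul_add, Finset.sum_add_distrib, Finset.smul_sum, smul_comm b, add_assoc]

section Recursion

variable {β : ℕ → ℝ} {s₀ x₀ : Fin n → Vec r} {η ξ : ℕ → Fin n → Vec r}

theorem algState_succ_fst {γ : ℕ → ℝ} (k : ℕ) :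
    (algState W f α γ β s₀ x₀ η ξ (k + 1)).1
      = W • (algState W f α γ β s₀ x₀ η ξ k).1 + β k • (offDiag W • η k)
        + γ k • gradStack f (algState W f α γ β s₀ x₀ η ξ k).2 := by
  ext1 i
  exact congrArg (· + _) (noisy_mixing_eq _ _ _ _)

theorem algState_succ_snd {γ : ℕ → ℝ} (k : ℕ) :
    (algState W f α γ β s₀ x₀ η ξ (k + 1)).2
      = W • (algState W f α γ β s₀ x₀ η ξ k).2 + β k • (offDiag W • ξ k)
        - α • ((algState W f α γ β s₀ x₀ η ξ (k + 1)).1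
          - (algState W f α γ β s₀ x₀ η ξ k).1) := by
  ext1 i
  exact congrArg (· - _) (noisy_mixing_eq _ _ _ _)

theorem algState_succ_fst_eq_add_tracker (k : ℕ) :
    (algState W f α (fun _ => γ) β s₀ x₀ η ξ (k + 1)).1
      = (algState W f α (fun _ => γ) β s₀ x₀ η ξ k).1
        + tracker W f γ (algState W f α (fun _ => γ) β s₀ x₀ η ξ k).1
          (algState W f α (fun _ => γ) β s₀ x₀ η ξ k).2
        + β k • (offDiag W • η k) := by
  rw [algState_succ_fst, tracker]
  abel

theorem algState_succ_snd_eq_xNext_add (k : ℕ) :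
    (algState W f α (fun _ => γ) β s₀ x₀ η ξ (k + 1)).2
      = xNext W α (algState W f α (fun _ => γ) β s₀ x₀ η ξ k).2
          (tracker W f γ (algState W f α (fun _ => γ) β s₀ x₀ η ξ k).1
            (algState W f α (fun _ => γ) β s₀ x₀ η ξ k).2)
        + (β k • (offDiag W • ξ k) - α • (β k • (offDiag W • η k))) := by
  rw [algState_succ_snd, algState_succ_fst_eq_add_tracker, add_assoc, add_sub_cancel_left, xNext,
    smul_add]
  abel

end Recursion

/-- The squared size of the noise injected by the algorithm at iteration `k`. -/
noncomputable def noiseEnergy (β : ℕ → ℝ) (η ξ : ℕ → Fin n → Vec r) (k : ℕ) : ℝ :=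
  β k ^ 2 * (stackNormSq (η k) + stackNormSq (ξ k))

theorem noiseEnergy_nonneg (β : ℕ → ℝ) (η ξ : ℕ → Fin n → Vec r) (k : ℕ) :
    0 ≤ noiseEnergy β η ξ k :=
  mul_nonneg (sq_nonneg _) (add_nonneg (stackNormSq_nonneg _) (stackNormSq_nonneg _))

theorem isHermitian_offDiag (hsymm : W.IsSymm) : (offDiag W).IsHermitian :=
  Matrix.IsHermitian.sub (Matrix.isHermitian_iff_isSymm.2 hsymm)
    (Matrix.isHermitian_diagonal _)

theorem stackNormSq_smul_offDiag_smul_le (hsymm : W.IsSymm) (b : ℝ) (ζ : Fin n → Vec r) :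
    stackNormSq (b • (offDiag W • ζ))
      ≤ (spectralRadius ℝ (offDiag W)).toReal ^ 2 * (b ^ 2 * stackNormSq ζ) := by
  rw [stackNormSq_smul, mul_left_comm]
  gcongr
  exact stackNormSq_matrix_smul_le_spectralRadius (isHermitian_offDiag hsymm) ζ

theorem exists_stackNormSq_perturbation_le (hsymm : W.IsSymm)
    (hf : ∀ i, HasLipschitzGradient L (f i)) (α γ : ℝ) :
    ∃ D, 0 < D ∧ ∀ x e d : Fin n → Vec r,
      stackNormSq (d - α • e) + stackNormSq (γ • (gradStack f (x + (d - α • e)) - gradStack f x)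
        + (W • e - e)) ≤ D * (stackNormSq e + stackNormSq d) := by
  set S := (spectralRadius ℝ (W - 1)).toReal ^ 2
  refine ⟨(1 + 2 * γ ^ 2 * L ^ 2) * (2 + 2 * α ^ 2) + 2 * S, by positivity, fun x e d => ?_⟩
  have he := stackNormSq_nonneg e
  have hd := stackNormSq_nonneg d
  have hu := stackNormSq_sub_le one_pos d (α • e)
  have hw := stackNormSq_add_le one_pos (γ • (gradStack f (x + (d - α • e)) - gradStack f x))
    (W • e - e)
  have hgrad := stackNormSq_gradStack_sub_le hf (x + (d - α • e)) x
  have hWe : stackNormSq (W • e - e) ≤ S * stackNormSq e := by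
    have hherm : (W - 1).IsHermitian :=
      Matrix.IsHermitian.sub (Matrix.isHermitian_iff_isSymm.2 hsymm) Matrix.isHermitian_one
    simpa only [sub_smul, one_smul] using stackNormSq_matrix_smul_le_spectralRadius hherm e
  rw [stackNormSq_smul] at hu hw
  rw [add_sub_cancel_left] at hgrad
  have hslack : 0 ≤ (1 + 2 * γ ^ 2 * L ^ 2) * (2 * α ^ 2 * stackNormSq d + 2 * stackNormSq e)
      + 2 * S * stackNormSq d := by positivity
  linear_combination hw + 2 * γ ^ 2 * hgrad + 2 * hWe + (1 + 2 * γ ^ 2 * L ^ 2) * hu + hslack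

theorem exists_lyapunov_noisy_step (hn : 0 < n) (hsymm : W.IsSymm) (hrow : ∀ i, ∑ j, W i j = 1)
    (hf : ∀ i, HasLipschitzGradient L (f i)) (hmono : HasStronglyMonotoneGradient μ (globalObj f))
    (hμ : 0 < μ) (hL : 0 < L) (hxstar : ∀ x, globalObj f xstar ≤ globalObj f x) (hα : 0 < α)
    (hγ : 0 < γ) (hstep : StableStepsize W L (α * γ)) :
    ∃ A c lam B : ℝ, 0 < A ∧ 0 < c ∧ 0 < lam ∧ lam < 1 ∧ 0 < B ∧ ∀ x z u w : Fin n → Vec r,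
      agentAvg z = γ • agentAvg (gradStack f x) →
        lyapunov A c f xstar (xNext W α x z + u) (zNext W f α γ x z + w)
          ≤ lam * lyapunov A c f xstar x z + B * (stackNormSq u + stackNormSq w) := by
  obtain ⟨A, c, lam, hA, hc, hlam0, hlam1, hcontr⟩ :=
    exists_lyapunov_contraction hn hsymm hrow hf hmono hμ hL hxstar hα hγ hstep
  obtain ⟨B, hB, hadd⟩ := exists_lyapunov_add_le hn hf hmono hμ hL hxstar hA hc
    (show 0 < (1 - lam) / (2 * lam) from div_pos (sub_pos.2 hlam1) (by positivity))
  refine ⟨A, c, (1 + lam) / 2, B, hA, hc, by linarith, by linarith, hB, fun x z u w hz => ?_⟩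
  have hmid : (1 + (1 - lam) / (2 * lam)) * lam = (1 + lam) / 2 := by field_simp; ring
  refine (hadd _ _ u w).trans (add_le_add_left ?_ _)
  rw [← hmid, mul_assoc]
  have : 0 ≤ 1 - lam := sub_nonneg.2 hlam1.le
  exact mul_le_mul_of_nonneg_left (hcontr x z hz) (by positivity)

theorem exists_lyapunov_algState_succ_le (hn : 0 < n) (hsymm : W.IsSymm)
    (hrow : ∀ i, ∑ j, W i j = 1) (hf : ∀ i, HasLipschitzGradient L (f i))
    (hmono : HasStronglyMonotoneGradient μ (globalObj f)) (hμ : 0 < μ) (hL : 0 < L)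
    (hxstar : ∀ x, globalObj f xstar ≤ globalObj f x) (hα : 0 < α) (hγ : 0 < γ)
    (hstep : StableStepsize W L (α * γ)) (s₀ x₀ : Fin n → Vec r) :
    ∃ A c lam D : ℝ, 0 < A ∧ 0 < c ∧ 0 < lam ∧ lam < 1 ∧ 0 ≤ D ∧
      ∀ (β : ℕ → ℝ) (η ξ : ℕ → Fin n → Vec r) (k : ℕ),
        let state := algState W f α (fun _ => γ) β s₀ x₀ η ξ
        let V := fun k => lyapunov A c f xstar (state k).2 (tracker W f γ (state k).1 (state k).2)
        V (k + 1) ≤ lam * V k + D * noiseEnergy β η ξ k := by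
  obtain ⟨A, c, lam, B, hA, hc, hlam0, hlam1, hB, hnoisy⟩ :=
    exists_lyapunov_noisy_step hn hsymm hrow hf hmono hμ hL hxstar hα hγ hstep
  obtain ⟨D, hD, hpert⟩ := exists_stackNormSq_perturbation_le hsymm hf α γ
  refine ⟨A, c, lam, B * (D * (spectralRadius ℝ (offDiag W)).toReal ^ 2), hA, hc, hlam0, hlam1,
    by positivity, fun β η ξ k => ?_⟩
  intro state V
  set e := β k • (offDiag W • η k)
  set d := β k • (offDiag W • ξ k)
  have he : stackNormSq e ≤ _ := stackNormSq_smul_offDiag_smul_le hsymm (β k) (η k)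
  have hd : stackNormSq d ≤ _ := stackNormSq_smul_offDiag_smul_le hsymm (β k) (ξ k)
  set z := tracker W f γ (state k).1 (state k).2 with hz
  have hx' : (state (k + 1)).2 = xNext W α (state k).2 z + (d - α • e) :=
    algState_succ_snd_eq_xNext_add k
  have hs' : (state (k + 1)).1 = (state k).1 + z + e := algState_succ_fst_eq_add_tracker k
  have hstepV := hnoisy (state k).2 z (d - α • e)
    (γ • (gradStack f (xNext W α (state k).2 z + (d - α • e))
      - gradStack f (xNext W α (state k).2 z)) + (W • e - e)) (agentAvg_tracker hsymm hrow _ _)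
  rw [hz, ← tracker_succ, ← hz, ← hs', ← hx'] at hstepV
  have hpert' := hpert (xNext W α (state k).2 z) e d
  rw [← hx'] at hpert'
  rw [noiseEnergy]
  linear_combination hstepV + B * hpert' + B * D * (he + hd)

theorem le_pow_mul_add_sum_of_succ_le {V b : ℕ → ℝ} {lam : ℝ} (hlam0 : 0 ≤ lam) (hlam1 : lam ≤ 1)
    (hb : ∀ k, 0 ≤ b k) (hV : ∀ k, V (k + 1) ≤ lam * V k + b k) (k : ℕ) :
    V k ≤ lam ^ k * V 0 + ∑ l ∈ Finset.range k, b l := by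
  induction k with
  | zero => simp
  | succ k ih =>
    have hsum : lam * ∑ l ∈ Finset.range k, b l ≤ ∑ l ∈ Finset.range k, b l :=
      mul_le_of_le_one_left (Finset.sum_nonneg fun l _ => hb l) hlam1
    rw [Finset.sum_range_succ]
    linear_combination hV k + lam * ih + hsum

theorem exists_errors_le_lyapunov (hn : 0 < n) (hf : ∀ i, Differentiable ℝ (f i))
    (hmono : HasStronglyMonotoneGradient μ (globalObj f)) (hμ : 0 < μ)
    (hxstar : ∀ x, globalObj f xstar ≤ globalObj f x) {A c : ℝ} (hA : 0 < A) (hc : 0 < c) :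
    ∃ K, 0 < K ∧ ∀ x z e : Fin n → Vec r,
      ‖agentAvg x - xstar‖ ^ 2 ≤ K * (lyapunov A c f xstar x z + stackNormSq e) ∧
      consensusSq x ≤ K * (lyapunov A c f xstar x z + stackNormSq e) ∧
      consensusSq (z + e) ≤ K * (lyapunov A c f xstar x z + stackNormSq e) := by
  refine ⟨2 / (μ * A) + 1 + (2 / c + 2), by positivity, fun x z e => ?_⟩
  have hgap : 0 ≤ globalObj f (agentAvg x) - globalObj f xstar := sub_nonneg.2 (hxstar _)
  have hX := consensusSq_nonneg x
  have hZ := consensusSq_nonneg z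
  have he := stackNormSq_nonneg e
  have hdist := hmono.mul_norm_sub_sq_le (differentiable_globalObj hf) hxstar (agentAvg x)
  have hT := add_nonneg (lyapunov_nonneg hA.le hc.le hxstar x z) he
  rw [lyapunov] at hT ⊢
  set gap := globalObj f (agentAvg x) - globalObj f xstar
  set T := A * gap + consensusSq x + c * consensusSq z + stackNormSq e
  have hgapT : A * gap ≤ T := by linarith [mul_nonneg hc.le hZ]
  have hXT : consensusSq x ≤ T := by linarith [mul_nonneg hA.le hgap, mul_nonneg hc.le hZ]
  have hZT : c * consensusSq z ≤ T := by linarith [mul_nonneg hA.le hgap]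
  have heT : stackNormSq e ≤ T := by linarith [mul_nonneg hA.le hgap, mul_nonneg hc.le hZ]
  have hK : ∀ {K'}, K' ≤ 2 / (μ * A) + 1 + (2 / c + 2) →
      K' * T ≤ (2 / (μ * A) + 1 + (2 / c + 2)) * T := fun h => mul_le_mul_of_nonneg_right h hT
  have hpos1 : 0 < 2 / (μ * A) := by positivity
  have hpos2 : 0 < 2 / c := by positivity
  refine ⟨?_, hXT.trans ?_, ?_⟩
  · calc ‖agentAvg x - xstar‖ ^ 2
        = 2 / μ * (μ / 2 * ‖agentAvg x - xstar‖ ^ 2) := by field_simp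
      _ ≤ 2 / μ * gap := by gcongr
      _ = 2 / (μ * A) * (A * gap) := by field_simp
      _ ≤ 2 / (μ * A) * T := by gcongr
      _ ≤ _ := hK (by linarith)
  · exact (one_mul T).symm.trans_le (hK (by linarith))
  · calc consensusSq (z + e) ≤ 2 * consensusSq z + 2 * stackNormSq e := by
          linarith [consensusSq_add_le hn one_pos z e]
      _ = 2 / c * (c * consensusSq z) + 2 * stackNormSq e := by field_simp
      _ ≤ 2 / c * T + 2 * T := by gcongr
      _ = (2 / c + 2) * T := by ring
      _ ≤ _ := hK (by linarith)

theorem exists_algState_errors_le_lyapunov (hn : 0 < n) (hsymm : W.IsSymm)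
    (hf : ∀ i, Differentiable ℝ (f i)) (hmono : HasStronglyMonotoneGradient μ (globalObj f))
    (hμ : 0 < μ) (hxstar : ∀ x, globalObj f xstar ≤ globalObj f x) {A c : ℝ} (hA : 0 < A)
    (hc : 0 < c) (α γ : ℝ) (s₀ x₀ : Fin n → Vec r) :
    ∃ K, 0 < K ∧ ∀ (β : ℕ → ℝ) (η ξ : ℕ → Fin n → Vec r) (k : ℕ),
      let state := algState W f α (fun _ => γ) β s₀ x₀ η ξ
      let bound := K * (lyapunov A c f xstar (state k).2 (tracker W f γ (state k).1 (state k).2)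
        + noiseEnergy β η ξ k)
      ‖agentAvg (state k).2 - xstar‖ ^ 2 ≤ bound ∧ consensusSq (state k).2 ≤ bound ∧
        consensusSq ((state (k + 1)).1 - (state k).1) ≤ bound := by
  obtain ⟨K, hK, herr⟩ := exists_errors_le_lyapunov hn hf hmono hμ hxstar hA hc
  set R := (spectralRadius ℝ (offDiag W)).toReal ^ 2
  refine ⟨K * (1 + R), by positivity, fun β η ξ k => ?_⟩
  intro state bound
  set V := lyapunov A c f xstar (state k).2 (tracker W f γ (state k).1 (state k).2)
  have hV : 0 ≤ V := lyapunov_nonneg hA.le hc.le hxstar _ _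
  have hnoise := noiseEnergy_nonneg β η ξ k
  have he : stackNormSq (β k • (offDiag W • η k)) ≤ R * noiseEnergy β η ξ k :=
    (stackNormSq_smul_offDiag_smul_le hsymm _ _).trans (mul_le_mul_of_nonneg_left
      (mul_le_mul_of_nonneg_left (le_add_of_nonneg_right (stackNormSq_nonneg _)) (sq_nonneg _))
      (sq_nonneg _))
  have hbound : K * (V + stackNormSq (β k • (offDiag W • η k))) ≤ bound := by
    have hslack : 0 ≤ R * V + noiseEnergy β η ξ k := by positivity
    simp only [bound]
    rw [mul_assoc]
    gcongr
    linear_combination he + hslack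
  have hincr : (state (k + 1)).1 - (state k).1
      = tracker W f γ (state k).1 (state k).2 + β k • (offDiag W • η k) := by
    simp only [state, algState_succ_fst_eq_add_tracker]
    abel
  rw [hincr]
  exact (herr _ _ _).imp hbound.trans' (And.imp hbound.trans' hbound.trans')

theorem exists_algState_errors_le (hn : 0 < n) (hsymm : W.IsSymm) (hrow : ∀ i, ∑ j, W i j = 1)
    (hf : ∀ i, HasLipschitzGradient L (f i)) (hmono : HasStronglyMonotoneGradient μ (globalObj f))
    (hμ : 0 < μ) (hL : 0 < L) (hxstar : ∀ x, globalObj f xstar ≤ globalObj f x) (hα : 0 < α)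
    (hγ : 0 < γ) (hstep : StableStepsize W L (α * γ)) (s₀ x₀ : Fin n → Vec r) :
    ∃ K lam : ℝ, 0 < K ∧ 0 < lam ∧ lam < 1 ∧
      ∀ (β : ℕ → ℝ) (η ξ : ℕ → Fin n → Vec r) (k : ℕ),
        let state := algState W f α (fun _ => γ) β s₀ x₀ η ξ
        let bound := K * (lam ^ k + ∑ l ∈ Finset.range (k + 1), noiseEnergy β η ξ l)
        ‖agentAvg (state k).2 - xstar‖ ^ 2 ≤ bound ∧ consensusSq (state k).2 ≤ bound ∧
          consensusSq ((state (k + 1)).1 - (state k).1) ≤ bound := by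
  obtain ⟨A, c, lam, D, hA, hc, hlam0, hlam1, hD, hV⟩ := exists_lyapunov_algState_succ_le hn hsymm
    hrow hf hmono hμ hL hxstar hα hγ hstep s₀ x₀
  obtain ⟨K, hK, herr⟩ := exists_algState_errors_le_lyapunov hn hsymm
    (fun i => (hf i).differentiable) hmono hμ hxstar hA hc α γ s₀ x₀
  set V₀ := lyapunov A c f xstar x₀ (tracker W f γ s₀ x₀)
  have hV₀ : 0 ≤ V₀ := lyapunov_nonneg hA.le hc.le hxstar _ _
  refine ⟨K * (1 + V₀ + D), lam, by positivity, hlam0, hlam1, fun β η ξ k => ?_⟩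
  intro state bound
  have hnoise := noiseEnergy_nonneg β η ξ
  have hVk : lyapunov A c f xstar (state k).2 (tracker W f γ (state k).1 (state k).2)
      ≤ lam ^ k * V₀ + ∑ l ∈ Finset.range k, D * noiseEnergy β η ξ l :=
    le_pow_mul_add_sum_of_succ_le
      (V := fun l => lyapunov A c f xstar (state l).2 (tracker W f γ (state l).1 (state l).2))
      hlam0.le hlam1.le (fun l => mul_nonneg hD (hnoise l)) (hV β η ξ) k
  have hbound : K * (lyapunov A c f xstar (state k).2 (tracker W f γ (state k).1 (state k).2)
      + noiseEnergy β η ξ k) ≤ bound := by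
    have hsum := Finset.sum_nonneg fun l (_ : l ∈ Finset.range k) => hnoise l
    have hslack : 0 ≤ (1 + D) * lam ^ k + (1 + V₀) * ∑ l ∈ Finset.range k, noiseEnergy β η ξ l
        + (V₀ + D) * noiseEnergy β η ξ k := by
      have := hnoise k
      positivity
    rw [← Finset.mul_sum] at hVk
    simp only [bound, Finset.sum_range_succ]
    rw [mul_assoc]
    gcongr
    linear_combination hVk + hslack
  exact (herr β η ξ k).imp hbound.trans' (And.imp hbound.trans' hbound.trans')

end Pathwise

/-! ### Moments of the noise -/

section Noise

variable {n r : ℕ} {W : Matrix (Fin n) (Fin n) ℝ} {f : Fin n → Vec r → ℝ} {L : ℝ}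
  {Ω : Type*} [MeasurableSpace Ω] {P : Measure Ω} {η ξ : ℕ → Fin n → Ω → Vec r}

theorem continuous_gradStack (hf : ∀ i, HasLipschitzGradient L (f i)) :
    Continuous (gradStack f) :=
  continuous_pi fun i => (hf i).continuous_gradient.comp (continuous_apply i)

theorem continuous_matrix_smul (A : Matrix (Fin n) (Fin n) ℝ) :
    Continuous fun z : Fin n → Vec r => A • z :=
  continuous_pi fun i => by
    simp only [Matrix.Module.smul_apply]
    exact continuous_finsetSum _ fun j _ => (continuous_apply j).const_smul (A i j)

theorem continuous_agentAvg : Continuous (agentAvg : (Fin n → Vec r) → Vec r) :=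
  (continuous_finsetSum _ fun j _ => continuous_apply j).const_smul (1 / (n : ℝ))

theorem continuous_consensusSq : Continuous (consensusSq : (Fin n → Vec r) → ℝ) :=
  continuous_finsetSum _ fun i _ => ((continuous_apply i).sub continuous_agentAvg).norm.pow 2

theorem aestronglyMeasurable_sIter_and_xIter (hf : ∀ i, HasLipschitzGradient L (f i)) (α : ℝ)
    (γ β : ℕ → ℝ) (s₀ x₀ : Fin n → Vec r)
    (hη : ∀ k, AEStronglyMeasurable (fun ω i => η k i ω) P)
    (hξ : ∀ k, AEStronglyMeasurable (fun ω i => ξ k i ω) P) (k : ℕ) :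
    AEStronglyMeasurable (sIter W f α γ β s₀ x₀ η ξ k) P ∧
      AEStronglyMeasurable (xIter W f α γ β s₀ x₀ η ξ k) P := by
  induction k with
  | zero => exact ⟨aestronglyMeasurable_const, aestronglyMeasurable_const⟩
  | succ k ih =>
    have hW := continuous_matrix_smul (r := r) W
    have hO := continuous_matrix_smul (r := r) (offDiag W)
    have hs : AEStronglyMeasurable (sIter W f α γ β s₀ x₀ η ξ (k + 1)) P :=
      (((hW.comp_aestronglyMeasurable ih.1).add
        ((hO.comp_aestronglyMeasurable (hη k)).const_smul (β k))).add
        (((continuous_gradStack hf).comp_aestronglyMeasurable ih.2).const_smul (γ k))).congr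
        (ae_of_all _ fun _ => (algState_succ_fst k).symm)
    exact ⟨hs, (((hW.comp_aestronglyMeasurable ih.2).add
      ((hO.comp_aestronglyMeasurable (hξ k)).const_smul (β k))).sub
      ((hs.sub ih.1).const_smul α)).congr (ae_of_all _ fun _ => (algState_succ_snd k).symm)⟩

theorem integrable_noiseEnergy (hη : ∀ k i, MemLp (η k i) 2 P) (hξ : ∀ k i, MemLp (ξ k i) 2 P)
    (β : ℕ → ℝ) (k : ℕ) :
    Integrable (fun ω => noiseEnergy β (fun l i => η l i ω) (fun l i => ξ l i ω) k) P :=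
  ((integrable_finsetSum _ fun i _ => (hη k i).integrable_norm_pow two_ne_zero).add
    (integrable_finsetSum _ fun i _ => (hξ k i).integrable_norm_pow two_ne_zero)).const_mul _

theorem integral_noiseEnergy_le (hη : ∀ k i, MemLp (η k i) 2 P) (hξ : ∀ k i, MemLp (ξ k i) 2 P)
    {vη vξ : ℝ} (β : ℕ → ℝ) {k : ℕ} (hvη : ∫ ω, ∑ i, ‖η k i ω‖ ^ 2 ∂P ≤ vη)
    (hvξ : ∫ ω, ∑ i, ‖ξ k i ω‖ ^ 2 ∂P ≤ vξ) :
    ∫ ω, noiseEnergy β (fun l i => η l i ω) (fun l i => ξ l i ω) k ∂P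
      ≤ β k ^ 2 * (vη + vξ) := by
  simp only [noiseEnergy, stackNormSq]
  rw [integral_const_mul, integral_add
    (integrable_finsetSum _ fun i _ => (hη k i).integrable_norm_pow two_ne_zero)
    (integrable_finsetSum _ fun i _ => (hξ k i).integrable_norm_pow two_ne_zero)]
  gcongr

theorem integrable_and_integral_le_of_le_mul_add_sum [IsProbabilityMeasure P] {Q : Ω → ℝ}
    {E : ℕ → Ω → ℝ} {K b : ℝ} {e : ℕ → ℝ} {N : ℕ} (hK : 0 ≤ K) (hQ : AEStronglyMeasurable Q P)
    (hQ0 : ∀ ω, 0 ≤ Q ω) (hE : ∀ l, Integrable (E l) P) (he : ∀ l, ∫ ω, E l ω ∂P ≤ e l)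
    (hle : ∀ ω, Q ω ≤ K * (b + ∑ l ∈ Finset.range N, E l ω)) :
    Integrable Q P ∧ ∫ ω, Q ω ∂P ≤ K * (b + ∑ l ∈ Finset.range N, e l) := by
  have hsum := integrable_finsetSum (Finset.range N) fun l _ => hE l
  have hbound := ((integrable_const b).add hsum).const_mul K
  have hint : Integrable Q P := hbound.mono' hQ (ae_of_all _ fun ω => by
    rw [Real.norm_of_nonneg (hQ0 ω)]
    exact hle ω)
  refine ⟨hint, ?_⟩
  calc ∫ ω, Q ω ∂P ≤ ∫ ω, K * (b + ∑ l ∈ Finset.range N, E l ω) ∂P :=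
        integral_mono hint hbound hle
    _ = K * (b + ∑ l ∈ Finset.range N, ∫ ω, E l ω ∂P) := by
        rw [integral_const_mul, integral_add (integrable_const b) hsum, integral_const,
          integral_finsetSum _ fun l _ => hE l, probReal_univ, one_smul]
    _ ≤ K * (b + ∑ l ∈ Finset.range N, e l) := by gcongr; exact he _

theorem exists_integral_errors_le [IsProbabilityMeasure P] {μ : ℝ} {xstar : Vec r} (hn : 0 < n)
    (hsymm : W.IsSymm) (hrow : ∀ i, ∑ j, W i j = 1) (hf : ∀ i, HasLipschitzGradient L (f i))
    (hmono : HasStronglyMonotoneGradient μ (globalObj f)) (hμ : 0 < μ) (hL : 0 < L)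
    (hxstar : ∀ x, globalObj f xstar ≤ globalObj f x)
    (hη : ∀ k i, MemLp (η k i) 2 P) (hξ : ∀ k i, MemLp (ξ k i) 2 P) {vη vξ : ℝ}
    (hvη : ∀ k, ∫ ω, ∑ i, ‖η k i ω‖ ^ 2 ∂P ≤ vη) (hvξ : ∀ k, ∫ ω, ∑ i, ‖ξ k i ω‖ ^ 2 ∂P ≤ vξ)
    {α γ : ℝ} (hα : 0 < α) (hγ : 0 < γ) (hstep : StableStepsize W L (α * γ))
    (s₀ x₀ : Fin n → Vec r) :
    ∃ K lam : ℝ, 0 < K ∧ 0 < lam ∧ lam < 1 ∧ ∀ (β : ℕ → ℝ) (k : ℕ),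
      let x := xIter W f α (fun _ => γ) β s₀ x₀ η ξ k
      let y := yIter W f α (fun _ => γ) β s₀ x₀ η ξ k
      let bound := K * (lam ^ k + (∑ l ∈ Finset.range (k + 1), β l ^ 2) * (vη + vξ))
      (Integrable (fun ω => ‖agentAvg (x ω) - xstar‖ ^ 2) P ∧
        ∫ ω, ‖agentAvg (x ω) - xstar‖ ^ 2 ∂P ≤ bound) ∧
      (Integrable (fun ω => consensusSq (x ω)) P ∧ ∫ ω, consensusSq (x ω) ∂P ≤ bound) ∧
      (Integrable (fun ω => consensusSq (y ω)) P ∧ ∫ ω, consensusSq (y ω) ∂P ≤ bound) := by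
  obtain ⟨K, lam, hK, hlam0, hlam1, hpath⟩ :=
    exists_algState_errors_le hn hsymm hrow hf hmono hμ hL hxstar hα hγ hstep s₀ x₀
  refine ⟨K, lam, hK, hlam0, hlam1, fun β k => ?_⟩
  intro x y bound
  have hmeas := aestronglyMeasurable_sIter_and_xIter (W := W) hf α (fun _ => γ) β s₀ x₀
    (fun l => (memLp_pi_iff.2 (hη l)).aestronglyMeasurable)
    (fun l => (memLp_pi_iff.2 (hξ l)).aestronglyMeasurable)
  have hx : AEStronglyMeasurable x P := (hmeas k).2
  have hy : AEStronglyMeasurable y P := (hmeas (k + 1)).1.sub (hmeas k).1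
  have hdist : Continuous fun z : Fin n → Vec r => ‖agentAvg z - xstar‖ ^ 2 :=
    (continuous_agentAvg.sub continuous_const).norm.pow 2
  have hpath ω := hpath β (fun l i => η l i ω) (fun l i => ξ l i ω) k
  simp only [bound, Finset.sum_mul]
  have hint {Q : Ω → ℝ} := integrable_and_integral_le_of_le_mul_add_sum (Q := Q) (P := P)
    (N := k + 1) (b := lam ^ k) hK.le (hE := integrable_noiseEnergy hη hξ β)
    (he := fun l => integral_noiseEnergy_le hη hξ β (hvη l) (hvξ l))
  exact ⟨hint (hdist.comp_aestronglyMeasurable hx) (fun _ => sq_nonneg _) fun ω => (hpath ω).1,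
    hint (continuous_consensusSq.comp_aestronglyMeasurable hx) (fun _ => consensusSq_nonneg _)
      fun ω => (hpath ω).2.1,
    hint (continuous_consensusSq.comp_aestronglyMeasurable hy) (fun _ => consensusSq_nonneg _)
      fun ω => (hpath ω).2.2⟩

end Noise

/-! ### The noise schedule -/

section Schedule

variable {m q : ℝ}

theorem gammaSeq_zero (γ m : ℝ) : gammaSeq γ m 0 = fun _ => γ := by
  funext k
  simp [gammaSeq]

theorem betaSeq_nonneg (hm : 0 ≤ m) (k : ℕ) : 0 ≤ betaSeq m q k := by
  unfold betaSeq
  positivity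

theorem betaSeq_sq_le (hm : Real.exp 2 ≤ m) (hq : 0 ≤ q) (k : ℕ) :
    betaSeq m q k ^ 2 ≤ Real.exp (-(4 * q)) := by
  have hbase : Real.exp 2 ≤ m + k := hm.trans (le_add_of_nonneg_right k.cast_nonneg)
  calc betaSeq m q k ^ 2 ≤ (1 / Real.exp 2 ^ q) ^ 2 := by
        have := betaSeq_nonneg (q := q) ((Real.exp_pos 2).le.trans hm) k
        unfold betaSeq at this ⊢
        gcongr
    _ = Real.exp (-(4 * q)) := by
        rw [← Real.exp_mul, one_div, ← Real.exp_neg, ← Real.exp_nat_mul]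
        ring_nf

theorem sum_betaSeq_sq_le (hm : Real.exp 2 ≤ m) {k : ℕ} (hk : (k : ℝ) ≤ q) :
    ∑ l ∈ Finset.range (k + 1), betaSeq m q l ^ 2 ≤ Real.exp (-(2 * k)) := by
  have hq : 0 ≤ q := k.cast_nonneg.trans hk
  calc ∑ l ∈ Finset.range (k + 1), betaSeq m q l ^ 2
      ≤ (k + 1) * Real.exp (-(4 * q)) := by
        simpa using Finset.sum_le_card_nsmul (Finset.range (k + 1)) _ _
          fun l _ => betaSeq_sq_le hm hq l
    _ ≤ Real.exp (2 * q) * Real.exp (-(4 * q)) := by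
        gcongr
        linarith [Real.add_one_le_exp (2 * q)]
    _ = Real.exp (-(2 * q)) := by rw [← Real.exp_add]; ring_nf
    _ ≤ Real.exp (-(2 * k)) := by gcongr

theorem eventually_exists_offset (m₀ : ℝ) {M : ℝ} (hM : 0 < M) :
    ∀ᶠ q : ℝ in atTop, ∃ m : ℝ, m₀ ≤ m ∧ (m / (m + 1)) ^ (2 * q) = Real.exp (-M) := by
  have hexp_pos {q : ℝ} (hq : 0 < q) : 0 < Real.exp (M / (2 * q)) - 1 :=
    sub_pos.2 (Real.one_lt_exp_iff.2 (by positivity))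
  have hgap : Tendsto (fun q : ℝ => Real.exp (M / (2 * q)) - 1) atTop
      (nhdsWithin 0 (Set.Ioi 0)) := by
    refine tendsto_nhdsWithin_iff.2 ⟨?_, (eventually_gt_atTop 0).mono fun _ => hexp_pos⟩
    have hquot : Tendsto (fun q : ℝ => M / (2 * q)) atTop (nhds 0) :=
      tendsto_const_nhds.div_atTop (tendsto_id.const_mul_atTop two_pos)
    simpa using ((Real.continuous_exp.tendsto 0).comp hquot).sub_const 1
  filter_upwards [eventually_gt_atTop 0, hgap.inv_tendsto_nhdsGT_zero.eventually_ge_atTop m₀]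
    with q hq hm₀
  refine ⟨_, hm₀, ?_⟩
  have hratio : (Real.exp (M / (2 * q)) - 1)⁻¹ / ((Real.exp (M / (2 * q)) - 1)⁻¹ + 1)
      = Real.exp (-(M / (2 * q))) := by
    have := (hexp_pos hq).ne'
    rw [Real.exp_neg]
    field_simp
    ring
  rw [Pi.inv_apply, hratio, ← Real.exp_mul]
  field_simp

theorem pow_le_exp_of_log_eq {lam M : ℝ} (hlam : 0 < lam) (hM : 0 < M)
    (hlog : Real.log lam = -(4 / M)) (k : ℕ) : lam ^ k ≤ Real.exp (-(4 * (k : ℝ)) / (2 + M)) := by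
  rw [← Real.exp_log hlam, ← Real.exp_nat_mul, hlog, Real.exp_le_exp]
  calc (k : ℝ) * -(4 / M) = -(4 * (k : ℝ) / M) := by ring
    _ ≤ -(4 * (k : ℝ) / (2 + M)) := by gcongr; linarith
    _ = -(4 * (k : ℝ)) / (2 + M) := (neg_div _ _).symm

theorem sum_betaSeq_sq_le_exp {M : ℝ} (hm : Real.exp 2 ≤ m) (hM : 0 ≤ M) {k : ℕ}
    (hk : (k : ℝ) ≤ q) :
    ∑ l ∈ Finset.range (k + 1), betaSeq m q l ^ 2 ≤ Real.exp (-(4 * (k : ℝ)) / (2 + M)) := by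
  refine (sum_betaSeq_sq_le hm hk).trans (Real.exp_le_exp.2 ?_)
  rw [le_div_iff₀ (by positivity)]
  linarith [mul_nonneg (k.cast_nonneg (α := ℝ)) hM]

end Schedule

end DPGradTracking

theorem corollary1_general {n r : ℕ} (hn : 0 < n)
    (W : Matrix (Fin n) (Fin n) ℝ) (hsymm : W.IsSymm) (hrow : ∀ i, ∑ j, W i j = 1)
    (f : Fin n → Vec r → ℝ) (μ L : ℝ) (hμ : 0 < μ) (hL : 0 < L)
    (hf : ∀ i, HasLipschitzGradient L (f i)) (hmono : HasStronglyMonotoneGradient μ (globalObj f))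
    (xstar : Vec r) (hxstar : ∀ x, globalObj f xstar ≤ globalObj f x)
    {Ω : Type*} [MeasurableSpace Ω] (P : Measure Ω) [IsProbabilityMeasure P]
    (η ξ : ℕ → Fin n → Ω → Vec r) (ση σξ : ℝ)
    (hη : ∀ k i, MemLp (η k i) 2 P) (hξ : ∀ k i, MemLp (ξ k i) 2 P)
    (hση : ∀ k, ∫ ω, ∑ i, ‖η k i ω‖ ^ 2 ∂P ≤ ση ^ 2)
    (hσξ : ∀ k, ∫ ω, ∑ i, ‖ξ k i ω‖ ^ 2 ∂P ≤ σξ ^ 2)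
    (s₀ x₀ : Fin n → Vec r)
    (α γ : ℝ) (hα : 0 < α) (hγ : 0 < γ) (hstep : StableStepsize W L (α * γ)) :
    ∃ a C : ℝ, 0 < a ∧ a < 1 ∧ 0 < C ∧
      ∀ᶠ q : ℝ in atTop, ∃ m : ℝ, 0 < m ∧ (m / (m + 1)) ^ (2 * q) = a ∧
        ∀ k : ℕ, (k : ℝ) ≤ q →
          let x := xIter W f α (gammaSeq γ m 0) (betaSeq m q) s₀ x₀ η ξ k
          let y := yIter W f α (gammaSeq γ m 0) (betaSeq m q) s₀ x₀ η ξ k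
          let bound := Real.exp (-(4 * (k : ℝ)) / (2 + Real.log (1 / a))) * C
          (Integrable (fun ω => ‖agentAvg (x ω) - xstar‖ ^ 2) P ∧
            ∫ ω, ‖agentAvg (x ω) - xstar‖ ^ 2 ∂P ≤ bound) ∧
          (Integrable (fun ω => consensusSq (x ω)) P ∧
            ∫ ω, consensusSq (x ω) ∂P ≤ bound) ∧
          (Integrable (fun ω => consensusSq (y ω)) P ∧
            ∫ ω, consensusSq (y ω) ∂P ≤ bound) := by
  obtain ⟨K, lam, hK, hlam0, hlam1, herr⟩ := exists_integral_errors_le hn hsymm hrow hf hmono hμ hL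
    hxstar hη hξ hση hσξ hα hγ hstep s₀ x₀
  have hlog : 0 < -Real.log lam := neg_pos.2 (Real.log_neg hlam0 hlam1)
  obtain ⟨M, hM, hlogM⟩ : ∃ M, 0 < M ∧ Real.log lam = -(4 / M) :=
    ⟨4 / -Real.log lam, by positivity, by field_simp⟩
  refine ⟨Real.exp (-M), K * (1 + (ση ^ 2 + σξ ^ 2)), Real.exp_pos _, by simpa using hM,
    by positivity, ?_⟩
  filter_upwards [eventually_exists_offset (Real.exp 2) hM] with q ⟨m, hm, hma⟩
  refine ⟨m, (Real.exp_pos 2).trans_le hm, hma, fun k hk => ?_⟩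
  rw [gammaSeq_zero, one_div, ← Real.exp_neg, neg_neg, Real.log_exp]
  intro x y bound
  have hbound : K * (lam ^ k + (∑ l ∈ Finset.range (k + 1), betaSeq m q l ^ 2)
      * (ση ^ 2 + σξ ^ 2)) ≤ bound := by
    rw [show bound = K * (Real.exp (-(4 * (k : ℝ)) / (2 + M)) + Real.exp (-(4 * (k : ℝ)) / (2 + M))
      * (ση ^ 2 + σξ ^ 2)) by simp only [bound]; ring]
    gcongr
    exacts [pow_le_exp_of_log_eq hlam0 hM hlogM k, sum_betaSeq_sq_le_exp hm hM.le hk]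
  obtain ⟨⟨hi₁, h₁⟩, ⟨hi₂, h₂⟩, ⟨hi₃, h₃⟩⟩ := herr (betaSeq m q) k
  exact ⟨⟨hi₁, h₁.trans hbound⟩, ⟨hi₂, h₂.trans hbound⟩, ⟨hi₃, h₃.trans hbound⟩⟩

theorem corollary1 {n r : ℕ} (hn : 0 < n)
    (W : Matrix (Fin n) (Fin n) ℝ) (hW : NetworkAssumption W)
    (f : Fin n → Vec r → ℝ) (μ L : ℝ) (hf : ObjectiveAssumption f μ L)
    (xstar : Vec r) (hxstar : ∀ x, globalObj f xstar ≤ globalObj f x)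
    {Ω : Type*} [MeasurableSpace Ω] (P : Measure Ω) [IsProbabilityMeasure P]
    (η ξ : ℕ → Fin n → Ω → Vec r) (ση σξ : ℝ) (hnoise : NoiseAssumption P η ξ ση σξ)
    (s₀ x₀ : Fin n → Vec r)
    (α γ : ℝ) (hα : 0 < α) (hγ : 0 < γ) (hstep : StepsizeCondition W μ L α γ) :
    ∃ a C : ℝ, 0 < a ∧ a < 1 ∧ 0 < C ∧
      ∀ᶠ q : ℝ in atTop, ∃ m : ℝ, 0 < m ∧ (m / (m + 1)) ^ (2 * q) = a ∧
        ∀ k : ℕ, (k : ℝ) ≤ q →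
          let x := xIter W f α (gammaSeq γ m 0) (betaSeq m q) s₀ x₀ η ξ k
          let y := yIter W f α (gammaSeq γ m 0) (betaSeq m q) s₀ x₀ η ξ k
          let bound := Real.exp (-(4 * (k : ℝ)) / (2 + Real.log (1 / a))) * C
          (Integrable (fun ω => ‖agentAvg (x ω) - xstar‖ ^ 2) P ∧
            ∫ ω, ‖agentAvg (x ω) - xstar‖ ^ 2 ∂P ≤ bound) ∧
          (Integrable (fun ω => consensusSq (x ω)) P ∧
            ∫ ω, consensusSq (x ω) ∂P ≤ bound) ∧
          (Integrable (fun ω => consensusSq (y ω)) P ∧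
            ∫ ω, consensusSq (y ω) ∂P ≤ bound) :=
  corollary1_general hn W hW.symm hW.row_sum f μ L hf.mu_pos hf.L_pos hf.hasLipschitzGradient
    (hasStronglyMonotoneGradient_globalObj hn hf.differentiable hf.strong) xstar hxstar P η ξ ση σξ
    (fun k i => memLp_piLp_iff.2 (hnoise.memLp_eta k i))
    (fun k i => memLp_piLp_iff.2 (hnoise.memLp_xi k i)) hnoise.var_eta hnoise.var_xi s₀ x₀ α γ hα hγ
    (hstep.stableStepsize hn hf.mu_pos hf.L_pos (mul_pos hα hγ))
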